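/- Let $\alpha,\beta>-1$, let $j\ge 0$ be an integer, let $\gamma\in\mathbb{R}$ and $M>0$, and let $\{M_n\}_{n\ge 0}$ be a sequence of nonnegative real numbers with $\lim_{n\to\infty}M_n n^{\gamma}=M$. For each $n\ge 0$ let $Q_n$ be the real polynomial of degree $n$ that is orthogonal to all real polynomials of degree less than $n$ with respect to $$(f,g)_{S,n}=\int_{-1}^1 f(x)g(x)(1-x)^{\alpha}(1+x)^{\beta}\,dx+M_n f^{(j)}(1)g^{(j)}(1)$$ and has the same leading coefficient as the Jacobi polynomial $P_n^{(\alpha,\beta)}$ normalized by $P_n^{(\alpha,\beta)}(1)=\binom{n+\alpha}{n}$. Let $J_\nu(x)=\sum_{k\ge0}\frac{(-1)^k}{k!\,\Gamma(k+\nu+1)}\left(\frac x2\right)^{2k+\nu}$ be the Bessel function of the first kind; $\left(\frac x2\right)^{-\alpha}J_{\alpha+2i}(x)$ denotes the corresponding entire function. Then $$\lim_{n\to\infty}\frac{Q_n(\cos(x/n))}{n^{\alpha}}=\lim_{n\to\infty}\frac{Q_n\left(1-\frac{x^2}{2n^2}\right)}{n^{\alpha}}=\begin{cases}\phi_{\alpha}(x),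 & \gamma>2(\alpha+2j+1),\\ \psi_{\alpha,j}(x), & \gamma=2(\alpha+2j+1),\\ \varphi_{\alpha,j}(x), & \gamma<2(\alpha+2j+1),\end{cases}$$ both limits being uniform on compact subsets of $\mathbb{C}$, where $$\phi_\alpha(x)=\left(\frac x2\right)^{-\alpha}J_\alpha(x),$$ and $\psi_{\alpha,j}$ and $\varphi_{\alpha,j}$ are both of the form $$\sum_{i=0}^{j+1}b_i2^{i}\left(\frac{x}{2}\right)^{-\alpha}J_{\alpha+2i}(x),$$ with coefficients computed recursively, for $0\le i\le j+1$, by $$b_i=(-1)^i\,\frac{r_i-\Gamma(\alpha+i+1)\sum_{k=0}^{i-1}b_k\binom{i}{k}\frac{(-1)^{k}k!\,2^{k}}{\Gamma(\alpha+i+k+1)}}{i!\,\frac{2^i\Gamma(\alpha+i+1)}{\Gamma(\alpha+2i+1)}}$$ (the empty sum is $0$). Here, for $\psi_{\alpha,j}$, $$r_i=\frac{M(i-j)+\Gamma^2(\alpha+j+1)2^{\alpha+\beta+2j+1}(\alpha+2j+1)(\alpha+j+i+1)}{(\alpha+j+i+1)\left(M+\Gamma^2(\alpha+j+1)2^{\alpha+\beta+2j+1}(\alpha+2j+1)\right)},$$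 and, for $\varphi_{\alpha,j}$, $$r_i=\frac{i-j}{\alpha+j+i+1}.$$ -/

import Mathlib

open Polynomial Filter Topology

noncomputable section

/-- The Jacobi polynomial `P_n^{(α,β)}`, normalized by `P_n^{(α,β)}(1) = (α+1)_n / n!`:
`(1/n!) ∑_{k ≤ n} binom(n,k) (n+α+β+1)_k (α+k+1)_{n-k} ((x-1)/2)^k`. -/
def jacobiPoly (α β : ℝ) (n : ℕ) : ℝ[X] :=
  ∑ k ∈ Finset.range (n + 1),
    C ((n.choose k : ℝ) * (ascPochhammer ℝ k).eval ((n : ℝ) + α + β + 1) *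
        (ascPochhammer ℝ (n - k)).eval (α + (k : ℝ) + 1) / (n.factorial : ℝ)) *
      (C (1 / 2 : ℝ) * (X - 1)) ^ k

/-- The discrete Jacobi–Sobolev inner product with mass `m` on the `j`-th derivative at `1`. -/
def sobolevInner (α β : ℝ) (j : ℕ) (m : ℝ) (f g : ℝ[X]) : ℝ :=
  (∫ x in (-1 : ℝ)..1, f.eval x * g.eval x * (1 - x) ^ α * (1 + x) ^ β) +
    m * (derivative^[j] f).eval 1 * (derivative^[j] g).eval 1

/-- `Q` is the degree `n` orthogonal polynomial of `sobolevInner α β j m`, with the same leading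
coefficient as `P_n^{(α,β)}`. -/
structure IsJacobiSobolev (α β : ℝ) (j : ℕ) (m : ℝ) (n : ℕ) (Q : ℝ[X]) : Prop where
  natDegree_eq : Q.natDegree = n
  leadingCoeff_eq : Q.leadingCoeff = (jacobiPoly α β n).leadingCoeff
  orthogonal : ∀ p : ℝ[X], p.degree < n → sobolevInner α β j m Q p = 0

/-- The Bessel function of the first kind `J_ν` (principal branch of the powers). -/
def besselJ (ν : ℝ) (z : ℂ) : ℂ :=
  ∑' k : ℕ, (-1 : ℂ) ^ k / ((k.factorial : ℂ) * (Real.Gamma (k + ν + 1) : ℂ)) *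
    (z / 2) ^ ((2 * k + ν : ℝ) : ℂ)

/-- The entire function `(z/2)^{-α} J_{α+2i}(z)`. At the removable singularity `z = 0` it takes its
limit value, which is `1/Γ(α+1)` for `i = 0` and `0` for `i ≥ 1`. -/
def scaledBessel (α : ℝ) (i : ℕ) (z : ℂ) : ℂ :=
  if z = 0 then (if i = 0 then 1 / (Real.Gamma (α + 1) : ℂ) else 0)
  else (z / 2) ^ (-α : ℂ) * besselJ (α + 2 * i) z

/-- The power series of `scaledBessel`, valid at every `z`, including `z = 0`. -/
theorem scaledBessel_eq_tsum (α : ℝ) (i : ℕ) (z : ℂ) :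
    scaledBessel α i z = ∑' k : ℕ, (-1 : ℂ) ^ k /
      ((k.factorial : ℂ) * (Real.Gamma (k + (α + 2 * i) + 1) : ℂ)) * (z / 2) ^ (2 * (k + i)) := by
  unfold scaledBessel
  split_ifs with hz hi
  · subst hz hi
    rw [tsum_eq_single 0]
    · simp
    · intro k hk
      simp [hk]
  · subst hz
    symm
    convert tsum_zero with k
    simp [hi]
  · unfold besselJ
    rw [← tsum_mul_left]
    congr 1
    ext k
    have hz2 : z / 2 ≠ 0 := by simpa using hz
    have he : (-α : ℂ) + ((2 * k + (α + 2 * i) : ℝ) : ℂ) = ((2 * (k + i) : ℕ) : ℂ) := by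
      push_cast
      ring
    rw [mul_left_comm, ← Complex.cpow_add _ _ hz2, he, Complex.cpow_natCast]

/-- The coefficients `b_i` computed recursively from the data `r`:
`b_i = (-1)^i (r_i - Γ(α+i+1) ∑_{k<i} b_k binom(i,k) (-1)^k k! 2^k / Γ(α+i+k+1))
  / (i! 2^i Γ(α+i+1) / Γ(α+2i+1))`. -/
def besselCoeff (α : ℝ) (r : ℕ → ℝ) (i : ℕ) : ℝ :=
  (-1) ^ i *
    (r i - Real.Gamma (α + i + 1) *
      ∑ k : Fin i, besselCoeff α r k * (i.choose k : ℝ) *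
        ((-1) ^ (k : ℕ) * ((k : ℕ).factorial : ℝ) * 2 ^ (k : ℕ)) /
          Real.Gamma (α + i + (k : ℕ) + 1)) /
    ((i.factorial : ℝ) * (2 ^ i * Real.Gamma (α + i + 1) / Real.Gamma (α + 2 * i + 1)))
termination_by i
decreasing_by exact k.isLt

/-- `Γ(α+j+1)² 2^{α+β+2j+1} (α+2j+1)`. -/
def criticalMass (α β : ℝ) (j : ℕ) : ℝ :=
  Real.Gamma (α + j + 1) ^ 2 * (2 : ℝ) ^ (α + β + 2 * j + 1) * (α + 2 * j + 1)

/-- The data of the recursion in the critical case `γ = 2(α+2j+1)`. -/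
def psiData (α β : ℝ) (j : ℕ) (M : ℝ) (i : ℕ) : ℝ :=
  (M * ((i : ℝ) - j) + criticalMass α β j * (α + j + i + 1)) /
    ((α + j + i + 1) * (M + criticalMass α β j))

/-- The data of the recursion in the case `γ < 2(α+2j+1)`. -/
def varphiData (α : ℝ) (j : ℕ) (i : ℕ) : ℝ :=
  ((i : ℝ) - j) / (α + j + i + 1)

/-- The function `∑_{i=0}^{j+1} b_i 2^i (z/2)^{-α} J_{α+2i}(z)`. -/
def besselCombination (α : ℝ) (j : ℕ) (b : ℕ → ℝ) (z : ℂ) : ℂ :=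
  ∑ i ∈ Finset.range (j + 2), (b i : ℂ) * 2 ^ i * scaledBessel α i z

def phiLimit (α : ℝ) (z : ℂ) : ℂ := scaledBessel α 0 z

def psiLimit (α β : ℝ) (j : ℕ) (M : ℝ) (z : ℂ) : ℂ :=
  besselCombination α j (besselCoeff α (psiData α β j M)) z

def varphiLimit (α : ℝ) (j : ℕ) (z : ℂ) : ℂ :=
  besselCombination α j (besselCoeff α (varphiData α j)) z

/-- Both `n^{-α} Q_n(cos(z/n))` and `n^{-α} Q_n(1 - z²/(2n²))` converge to `F`, uniformly on
compact subsets of `ℂ`. -/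
def MehlerHeine (α : ℝ) (Q : ℕ → ℝ[X]) (F : ℂ → ℂ) : Prop :=
  ∀ K : Set ℂ, IsCompact K →
    TendstoUniformlyOn
      (fun (n : ℕ) (z : ℂ) => aeval (Complex.cos (z / n)) (Q n) / (((n : ℝ) ^ α : ℝ) : ℂ))
      F atTop K ∧
    TendstoUniformlyOn
      (fun (n : ℕ) (z : ℂ) => aeval (1 - z ^ 2 / (2 * (n : ℂ) ^ 2)) (Q n) / (((n : ℝ) ^ α : ℝ) : ℂ))
      F atTop K

end

/-!
Expanding at `1` turns both substitutions into one power series in a variable converging to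
`-z² / 2`, so only the Taylor coefficients of `Q_n` at `1` matter. Orthogonality makes `Q_n` the
Jacobi polynomial minus a multiple of the `j`-th derivative, in one variable at `1`, of the
Christoffel–Darboux kernel; evaluating the `j`-th derivative at `1` determines the multiple. Hence
the `i`-th coefficient is `t_i - e t_j K_i`, where `t_i` and `K_i` are explicit, grow like
`n ^ (α + 2 i)` and `n ^ (2 (α + i + j + 1))`, and `e` is a damped mass; the three regimes of `γ`
differ only in the limit of `e n ^ (2 (α + 2 j + 1))`. Bounds of `t_i` and `K_i` by
exponential-type majorants, uniform in `n`, allow the limit to be taken under the sum.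

The limit series is that of `φ_α` with its coefficients multiplied by `r_i`. Since
`(α + j + i + 1) r_i` is affine in `i`, the expansion of such a multiple in the functions
`(z/2)^{-α} J_{α+2i}(z)` stops at `i = j + 1`, which is where the recursion for `b_i` comes from.
-/

namespace JacobiSobolev

open scoped Asymptotics

/-! ### Pochhammer symbols and finite differences -/

theorem ascPochhammer_add_eval {S : Type*} [CommSemiring S] (x : S) (a b : ℕ) :
    (ascPochhammer S (a + b)).eval x =
      (ascPochhammer S a).eval x * (ascPochhammer S b).eval (x + a) := by
  simp [← ascPochhammer_mul]

theorem Gamma_add_natCast {x : ℝ} (hx : 0 < x) (n : ℕ) :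
    Real.Gamma (x + n) = (ascPochhammer ℝ n).eval x * Real.Gamma x := by
  induction n with
  | zero => simp
  | succ n ih =>
    rw [ascPochhammer_succ_eval, Nat.cast_succ, ← add_assoc,
      Real.Gamma_add_one (by positivity : x + n ≠ 0), ih]
    ring

theorem pow_le_ascPochhammer_eval {x : ℝ} (hx : 0 ≤ x) (n : ℕ) :
    x ^ n ≤ (ascPochhammer ℝ n).eval x := by
  induction n with
  | zero => simp
  | succ n ih =>
    rw [ascPochhammer_succ_eval, pow_succ]
    exact mul_le_mul ih (by simp) hx ((pow_nonneg hx n).trans ih)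

theorem ascPochhammer_eval_le_pow {x : ℝ} (hx : 0 ≤ x) (n : ℕ) :
    (ascPochhammer ℝ n).eval x ≤ (x + n) ^ n := by
  induction n with
  | zero => simp
  | succ n ih =>
    rw [ascPochhammer_succ_eval, pow_succ, Nat.cast_succ]
    have h : (x + n) ^ n ≤ (x + (n + 1)) ^ n := by gcongr; simp
    exact mul_le_mul (ih.trans h) (by simp) (by positivity) (by positivity)

theorem fwdDiff_iter_one_eq_sum {R : Type*} [CommRing R] (f : R → R) (n : ℕ) (x : R) :
    (fwdDiff 1)^[n] f x =
      (-1) ^ n * ∑ k ∈ Finset.range (n + 1), (-1) ^ k * n.choose k * f (x + k) := by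
  rw [fwdDiff_iter_eq_sum_shift, Finset.mul_sum]
  refine Finset.sum_congr rfl fun k hk => ?_
  obtain ⟨l, rfl⟩ := Nat.exists_eq_add_of_le (Finset.mem_range_succ_iff.mp hk)
  have hsq : (-1 : R) ^ k * (-1) ^ k = 1 := by simp [← mul_pow]
  simp only [add_tsub_cancel_left, zsmul_eq_mul, nsmul_eq_mul, mul_one, pow_add]
  push_cast
  linear_combination (-(-1) ^ l * ((k + l).choose k : R) * f (x + k)) * hsq

theorem sum_neg_one_pow_mul_choose_mul_eval_eq_zero {R : Type*} [CommRing R] {p : R[X]} {n : ℕ}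
    (hp : p.natDegree < n) :
    ∑ k ∈ Finset.range (n + 1), (-1) ^ k * n.choose k * p.eval (k : R) = 0 := by
  have h := congrFun (fwdDiff_iter_eq_zero_of_degree_lt hp) 0
  rw [fwdDiff_iter_one_eq_sum] at h
  simpa only [zero_add, Pi.zero_apply, (isUnit_one.neg.pow n).mul_right_eq_zero] using h

theorem fwdDiff_iter_inv {K : Type*} [Field K] (n : ℕ) {c : K}
    (hc : (ascPochhammer K (n + 1)).eval c ≠ 0) :
    (fwdDiff 1)^[n] (fun x : K => x⁻¹) c =
      (-1) ^ n * n.factorial / (ascPochhammer K (n + 1)).eval c := by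
  induction n generalizing c with
  | zero => simp
  | succ n ih =>
    have hright := ascPochhammer_succ_eval (n + 1) c
    have hleft : (ascPochhammer K (n + 1 + 1)).eval c =
        c * (ascPochhammer K (n + 1)).eval (c + 1) := by
      rw [add_comm (n + 1) 1, ascPochhammer_add_eval]
      simp
    have hc₀ := left_ne_zero_of_mul (hright ▸ hc)
    have hc₁ := right_ne_zero_of_mul (hleft ▸ hc)
    rw [Function.iterate_succ_apply', fwdDiff, ih hc₀, ih hc₁, div_sub_div _ _ hc₁ hc₀,
      div_eq_div_iff (mul_ne_zero hc₁ hc₀) hc, Nat.factorial_succ]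
    rw [hleft] at hright ⊢
    push_cast at hright ⊢
    linear_combination
      (-((-1) ^ n * (n.factorial : K)) * (ascPochhammer K (n + 1)).eval (c + 1)) * hright

theorem sum_neg_one_pow_mul_choose_div {K : Type*} [Field K] (n : ℕ) {c : K}
    (hc : (ascPochhammer K (n + 1)).eval c ≠ 0) :
    ∑ k ∈ Finset.range (n + 1), (-1) ^ k * n.choose k * (c + k)⁻¹ =
      n.factorial / (ascPochhammer K (n + 1)).eval c := by
  have h := fwdDiff_iter_inv n hc
  rw [fwdDiff_iter_one_eq_sum, mul_div_assoc] at h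
  exact mul_left_cancel₀ (pow_ne_zero _ (by simp)) h

theorem sum_neg_one_pow_mul_choose_mul_eval_div {p : ℝ[X]} {n : ℕ} (hp : p.natDegree ≤ n) {c : ℝ}
    (hc : 0 < c) :
    ∑ k ∈ Finset.range (n + 1), (-1) ^ k * (n.choose k : ℝ) * (p.eval (k : ℝ) / (c + k)) =
      p.eval (-c) * (n.factorial / (ascPochhammer ℝ (n + 1)).eval c) := by
  -- Removing the pole at `-c` leaves a polynomial of degree less than `n`, killed by the sum.
  obtain ⟨q, hq⟩ : X - C (-c) ∣ p - C (p.eval (-c)) :=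
    dvd_iff_isRoot.mpr (by simp)
  have hsplit (k : ℕ) : p.eval (k : ℝ) / (c + k) = p.eval (-c) * (c + k)⁻¹ + q.eval (k : ℝ) := by
    have h := congrArg (eval (k : ℝ)) hq
    simp only [eval_sub, eval_C, eval_mul, eval_X, sub_neg_eq_add] at h
    field_simp
    linear_combination h
  have hsum : ∑ k ∈ Finset.range (n + 1), (-1) ^ k * (n.choose k : ℝ) * q.eval (k : ℝ) = 0 := by
    rcases eq_or_ne q 0 with rfl | hq₀
    · simp
    apply sum_neg_one_pow_mul_choose_mul_eval_eq_zero
    have h := congrArg natDegree hq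
    rw [natDegree_sub_C, (monic_X_sub_C _).natDegree_mul' hq₀, natDegree_X_sub_C] at h
    omega
  simp_rw [hsplit, mul_add, Finset.sum_add_distrib]
  rw [hsum, add_zero, ← sum_neg_one_pow_mul_choose_div n (ascPochhammer_pos _ _ hc).ne',
    Finset.mul_sum]
  exact Finset.sum_congr rfl fun k _ => by ring

/-! ### Power asymptotics -/

theorem tendsto_div_of_isEquivalent_const_mul {ι : Type*} {l : Filter ι} {f g : ι → ℝ} {c : ℝ}
    (h : f ~[l] fun x => c * g x) (hg : ∀ᶠ x in l, g x ≠ 0) :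
    Tendsto (fun x => f x / g x) l (𝓝 c) := by
  have hratio : (fun x => c * g x / g x) =ᶠ[l] fun _ => c :=
    hg.mono fun x hx => mul_div_cancel_right₀ c hx
  exact ((h.div .refl).trans hratio.isEquivalent).symm.tendsto_nhds tendsto_const_nhds

theorem isEquivalent_natCast_add (c : ℝ) :
    (fun n : ℕ => (n : ℝ) + c) ~[atTop] fun n => (n : ℝ) :=
  Asymptotics.IsEquivalent.refl.add_isLittleO
    ((Asymptotics.isLittleO_const_id_atTop c).comp_tendsto tendsto_natCast_atTop_atTop)

theorem isEquivalent_ascPochhammer_eval_natCast_add (c : ℝ) (i : ℕ) :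
    (fun n : ℕ => (ascPochhammer ℝ i).eval ((n : ℝ) + c)) ~[atTop] fun n => (n : ℝ) ^ i := by
  induction i with
  | zero => simpa using Asymptotics.IsEquivalent.refl
  | succ i ih =>
    simp only [ascPochhammer_succ_eval, pow_succ, add_assoc]
    exact ih.mul (isEquivalent_natCast_add (c + i))

theorem isEquivalent_Gamma_natCast_add_of_pos {a : ℝ} (ha : 0 < a) :
    (fun n : ℕ => Real.Gamma (n + a + 1)) ~[atTop] fun n => n.factorial * (n : ℝ) ^ a := by
  have hΓ := Real.Gamma_pos_of_pos ha
  have hseq : Real.GammaSeq a ~[atTop] fun _ => Real.Gamma a :=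
    (Asymptotics.isEquivalent_const_iff_tendsto hΓ.ne').mpr (Real.GammaSeq_tendsto_Gamma a)
  have hprod (n : ℕ) : ∏ k ∈ Finset.range n, (a + (k : ℝ)) = (ascPochhammer ℝ n).eval a := by
    induction n with
    | zero => simp
    | succ n ih => rw [Finset.prod_range_succ, ih, ascPochhammer_succ_eval]
  have hmul : (fun n : ℕ => Real.Gamma (n + a + 1) * Real.GammaSeq a n) =
      fun n : ℕ => n.factorial * (n : ℝ) ^ a * Real.Gamma a := by
    funext n
    have hpos := ascPochhammer_pos (n + 1) a ha
    rw [Real.GammaSeq, hprod, show (n : ℝ) + a + 1 = a + (n + 1 : ℕ) by push_cast; ring,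
      Gamma_add_natCast ha]
    field_simp
  have hquot := (EventuallyEq.of_eq hmul).isEquivalent (l := atTop).div hseq
  refine (hquot.congr_left ?_).congr_right (.of_forall fun n => mul_div_cancel_right₀ _ hΓ.ne')
  filter_upwards [(Real.GammaSeq_tendsto_Gamma a).eventually_ne hΓ.ne'] with n hn
  exact mul_div_cancel_right₀ _ hn

theorem isEquivalent_Gamma_natCast_add (a : ℝ) :
    (fun n : ℕ => Real.Gamma (n + a + 1)) ~[atTop] fun n => n.factorial * (n : ℝ) ^ a := by
  suffices h : ∀ (k : ℕ) (a : ℝ), 0 < a + k → (fun n : ℕ => Real.Gamma (n + a + 1)) ~[atTop]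
      fun n => n.factorial * (n : ℝ) ^ a by
    obtain ⟨k, hk⟩ := exists_nat_gt (-a)
    exact h k a (by linarith)
  intro k
  induction k with
  | zero => exact fun a ha => isEquivalent_Gamma_natCast_add_of_pos (by simpa using ha)
  | succ k ih =>
    intro a ha
    refine (((ih (a + 1) (by push_cast at ha; linarith)).div
      (isEquivalent_natCast_add (a + 1))).congr_left ?_).congr_right ?_
    · filter_upwards [tendsto_natCast_atTop_atTop.eventually_gt_atTop (-(a + 1))] with n hn
      have hne : (n : ℝ) + (a + 1) ≠ 0 := by linarith
      rw [Pi.div_apply, Real.Gamma_add_one hne, mul_div_cancel_left₀ _ hne, add_assoc]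
    · filter_upwards [eventually_ne_atTop 0] with n hn
      have hne : (n : ℝ) ≠ 0 := Nat.cast_ne_zero.mpr hn
      rw [Pi.div_apply, Real.rpow_add_one hne, ← mul_assoc, mul_div_cancel_right₀ _ hne]

theorem isEquivalent_rpow_natCast_add_one_sub {q : ℝ} (hq : q ≠ 0) :
    (fun n : ℕ => ((n : ℝ) + 1) ^ q - (n : ℝ) ^ q) ~[atTop] fun n => q * (n : ℝ) ^ (q - 1) := by
  have hslope := (Real.hasDerivAt_rpow_const (x := 1) (p := q)
    (Or.inl one_ne_zero)).tendsto_slope_zero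
  have hinv : Tendsto (fun n : ℕ => (n : ℝ)⁻¹) atTop (𝓝[≠] 0) :=
    tendsto_nhdsWithin_iff.mpr ⟨tendsto_inv_atTop_nhds_zero_nat,
      (eventually_ne_atTop 0).mono fun n hn => by simpa using hn⟩
  have hlim := hslope.comp hinv
  rw [Real.one_rpow (q - 1), mul_one, ← Asymptotics.isEquivalent_const_iff_tendsto hq] at hlim
  refine (hlim.mul (.refl (u := fun n : ℕ => (n : ℝ) ^ (q - 1)))).congr_left ?_
  filter_upwards [eventually_gt_atTop 0] with n hn
  have hn' : (0 : ℝ) < n := by exact_mod_cast hn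
  have := Real.rpow_pos_of_pos hn' q
  simp only [Pi.mul_apply, Function.comp_apply, inv_inv, smul_eq_mul, Real.one_rpow]
  rw [show (n : ℝ) + 1 = n * (1 + (n : ℝ)⁻¹) by field_simp, Real.mul_rpow hn'.le (by positivity),
    Real.rpow_sub_one hn'.ne']
  field_simp

theorem isEquivalent_sum_range {f g : ℕ → ℝ} (h : f ~[atTop] g) (hg : 0 ≤ g)
    (hsum : Tendsto (fun n => ∑ k ∈ Finset.range n, g k) atTop atTop) :
    (fun n => ∑ k ∈ Finset.range n, f k) ~[atTop] fun n => ∑ k ∈ Finset.range n, g k := by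
  have hdiff := h.isLittleO.sum_range hg hsum
  simp only [Pi.sub_apply, Finset.sum_sub_distrib] at hdiff
  exact hdiff

theorem isEquivalent_sum_range_of_rpow {f : ℕ → ℝ} {A q : ℝ} (hA : 0 < A) (hq : 0 < q)
    (hf : f ~[atTop] fun n => A * (n : ℝ) ^ (q - 1)) :
    (fun n => ∑ k ∈ Finset.range n, f k) ~[atTop] fun n => A / q * (n : ℝ) ^ q := by
  set g : ℕ → ℝ := fun n => A / q * (((n : ℝ) + 1) ^ q - (n : ℝ) ^ q)
  have hg : 0 ≤ g := fun n => mul_nonneg (by positivity)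
    (sub_nonneg.mpr (Real.rpow_le_rpow n.cast_nonneg (by linarith) hq.le))
  have hfg : f ~[atTop] g := by
    refine hf.trans (((Asymptotics.IsEquivalent.refl (u := fun _ : ℕ => A / q)).mul
      (isEquivalent_rpow_natCast_add_one_sub hq.ne')).symm.congr_left (.of_forall fun n => ?_))
    simp only [Pi.mul_apply]
    field_simp
  have hsum (n : ℕ) : ∑ k ∈ Finset.range n, g k = A / q * (n : ℝ) ^ q := by
    have h := Finset.sum_range_sub (fun k : ℕ => (k : ℝ) ^ q) n
    simp only [Nat.cast_succ, Nat.cast_zero, Real.zero_rpow hq.ne', sub_zero] at h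
    rw [← Finset.mul_sum, h]
  have hlim : Tendsto (fun n => ∑ k ∈ Finset.range n, g k) atTop atTop := by
    simp_rw [hsum]
    exact ((tendsto_rpow_atTop hq).comp tendsto_natCast_atTop_atTop).const_mul_atTop (by positivity)
  simpa only [hsum] using isEquivalent_sum_range hfg hg hlim

/-! ### Kernel polynomials of orthogonal sequences -/

section OrthogonalSequence

variable {K : Type*} [Field K] {L : K[X] →ₗ[K] K} {P : Polynomial.Sequence K}

theorem eq_sum_of_degree_lt (horth : Pairwise fun k l => L (P k * P l) = 0)
    (hne : ∀ k, L (P k * P k) ≠ 0) {n : ℕ} {p : K[X]} (hp : p.degree < n) :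
    p = ∑ k ∈ Finset.range n, (L (p * P k) / L (P k * P k)) • P k := by
  let expansion : K[X] →ₗ[K] K[X] := ∑ k ∈ Finset.range n,
    ((L (P k * P k))⁻¹ • L ∘ₗ LinearMap.mulRight K (P k)).smulRight (P k)
  have happly (q : K[X]) :
      expansion q = ∑ k ∈ Finset.range n, (L (q * P k) / L (P k * P k)) • P k := by
    simp [expansion, div_eq_inv_mul]
  have hbasis : Set.EqOn (LinearMap.id : K[X] →ₗ[K] K[X]) expansion (P '' Set.Iio n) := by
    rintro _ ⟨l, hl, rfl⟩
    rw [happly, Finset.sum_eq_single_of_mem l (Finset.mem_range.mpr hl), div_self (hne l), one_smul,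
      LinearMap.id_apply]
    intro k _ hk
    rw [horth hk.symm, zero_div, zero_smul]
  rw [← happly]
  refine LinearMap.eqOn_span hbasis ?_
  rw [P.span_degreeLT fun k _ => (leadingCoeff_ne_zero.mpr (P.ne_zero k)).isUnit]
  exact mem_degreeLT.mpr hp

variable (L P) in
/-- The kernel polynomial of degree less than `n` of the orthogonal sequence `P`: it represents the
linear functional `Λ` on polynomials of degree less than `n` through `L`. For `Λ` the evaluation at
`y` it is the Christoffel–Darboux kernel `K_{n-1}(·, y)`. -/
noncomputable def kernelPoly (Λ : K[X] →ₗ[K] K) (n : ℕ) : K[X] :=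
  ∑ k ∈ Finset.range n, (Λ (P k) / L (P k * P k)) • P k

theorem eq_sub_smul_kernelPoly (horth : Pairwise fun k l => L (P k * P l) = 0)
    (hne : ∀ k, L (P k * P k) ≠ 0) {Λ : K[X] →ₗ[K] K} {m : K} {n : ℕ} {Q : K[X]}
    (hdeg : (Q - P n).degree < n) (hQ : ∀ k < n, L (Q * P k) + m * Λ Q * Λ (P k) = 0) :
    Q = P n - (m * Λ Q) • kernelPoly L P Λ n := by
  have hcoeff : ∀ k < n, L ((Q - P n) * P k) = -(m * Λ Q * Λ (P k)) := fun k hk => by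
    rw [sub_mul, map_sub, horth hk.ne']
    linear_combination hQ k hk
  suffices h : Q - P n = -((m * Λ Q) • kernelPoly L P Λ n) by
    rw [sub_eq_add_neg, ← h, add_sub_cancel]
  rw [eq_sum_of_degree_lt horth hne hdeg, kernelPoly, Finset.smul_sum, ← Finset.sum_neg_distrib]
  refine Finset.sum_congr rfl fun k hk => ?_
  rw [hcoeff k (Finset.mem_range.mp hk), smul_smul, ← neg_smul]
  congr 1
  ring

end OrthogonalSequence

/-! ### The Jacobi weight -/

theorem integral_rpow_mul_one_sub_rpow {u v : ℝ} (hu : 0 < u) (hv : 0 < v) :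
    ∫ x in (0 : ℝ)..1, x ^ (u - 1) * (1 - x) ^ (v - 1) = ProbabilityTheory.beta u v := by
  have hcast : Complex.betaIntegral u v =
      ((∫ x in (0 : ℝ)..1, x ^ (u - 1) * (1 - x) ^ (v - 1) : ℝ) : ℂ) := by
    rw [Complex.betaIntegral, ← intervalIntegral.integral_ofReal]
    refine intervalIntegral.integral_congr fun x hx => ?_
    rw [Set.uIcc_of_le zero_le_one] at hx
    push_cast
    rw [Complex.ofReal_cpow hx.1, Complex.ofReal_cpow (sub_nonneg.mpr hx.2)]
    push_cast
    rfl
  rw [ProbabilityTheory.beta_eq_betaIntegralReal u v hu hv, hcast, Complex.ofReal_re]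

theorem integral_jacobi_weight {a b : ℝ} (ha : -1 < a) (hb : -1 < b) :
    ∫ x in (-1 : ℝ)..1, (1 - x) ^ a * (1 + x) ^ b =
      2 ^ (a + b + 1) * ProbabilityTheory.beta (a + 1) (b + 1) := by
  have hsubst := intervalIntegral.smul_integral_comp_sub_mul
    (a := 0) (b := 1) (fun x : ℝ => (1 - x) ^ a * (1 + x) ^ b) 2 1
  norm_num at hsubst
  rw [← hsubst, ← integral_rpow_mul_one_sub_rpow (by linarith) (by linarith),
    ← intervalIntegral.integral_const_mul, ← intervalIntegral.integral_const_mul]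
  refine intervalIntegral.integral_congr fun x hx => ?_
  rw [Set.uIcc_of_le zero_le_one] at hx
  simp only [add_sub_cancel_right]
  rw [show 1 + (1 - 2 * x) = 2 * (1 - x) by ring, Real.mul_rpow two_pos.le hx.1,
    Real.mul_rpow two_pos.le (sub_nonneg.mpr hx.2), Real.rpow_add two_pos, Real.rpow_add two_pos,
    Real.rpow_one]
  ring

theorem integral_jacobi_weight_pos {a b : ℝ} (ha : -1 < a) (hb : -1 < b) :
    0 < ∫ x in (-1 : ℝ)..1, (1 - x) ^ a * (1 + x) ^ b := by
  rw [integral_jacobi_weight ha hb]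
  exact mul_pos (by positivity) (ProbabilityTheory.beta_pos (by linarith) (by linarith))

theorem intervalIntegrable_jacobi_weight {a b : ℝ} (ha : -1 < a) (hb : -1 < b) :
    IntervalIntegrable (fun x : ℝ => (1 - x) ^ a * (1 + x) ^ b) MeasureTheory.volume (-1) 1 := by
  by_contra h
  exact (integral_jacobi_weight_pos ha hb).ne' (intervalIntegral.integral_undef h)

/-- Integration of polynomials against the Jacobi weight, as a linear functional. -/
noncomputable def jacobiFunctional {α β : ℝ} (hα : -1 < α) (hβ : -1 < β) : ℝ[X] →ₗ[ℝ] ℝ where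
  toFun p := ∫ x in (-1 : ℝ)..1, p.eval x * ((1 - x) ^ α * (1 + x) ^ β)
  map_add' p q := by
    have hint (p : ℝ[X]) : IntervalIntegrable (fun x : ℝ => p.eval x * ((1 - x) ^ α * (1 + x) ^ β))
        MeasureTheory.volume (-1) 1 :=
      (intervalIntegrable_jacobi_weight hα hβ).continuousOn_mul p.continuous.continuousOn
    rw [← intervalIntegral.integral_add (hint p) (hint q)]
    simp only [eval_add, add_mul]
  map_smul' c p := by
    simp only [eval_smul, smul_eq_mul, RingHom.id_apply, mul_assoc,
      intervalIntegral.integral_const_mul]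

variable {α β : ℝ}

theorem jacobiFunctional_apply (hα : -1 < α) (hβ : -1 < β) (p : ℝ[X]) :
    jacobiFunctional hα hβ p = ∫ x in (-1 : ℝ)..1, p.eval x * ((1 - x) ^ α * (1 + x) ^ β) := rfl

theorem jacobiFunctional_X_sub_one_pow (hα : -1 < α) (hβ : -1 < β) (s : ℕ) :
    jacobiFunctional hα hβ ((X - 1) ^ s) = (-2) ^ s * 2 ^ (α + β + 1) *
      (Real.Gamma (α + s + 1) * Real.Gamma (β + 1) / Real.Gamma (α + β + s + 2)) := by
  have hs : (0 : ℝ) ≤ s := s.cast_nonneg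
  have hweight := integral_jacobi_weight (a := α + s) (b := β) (by linarith) hβ
  rw [ProbabilityTheory.beta, show α + s + β + 1 = α + β + 1 + s by ring,
    show α + s + 1 + (β + 1) = α + β + s + 2 by ring, Real.rpow_add two_pos,
    Real.rpow_natCast] at hweight
  rw [show (-2 : ℝ) ^ s = (-1) ^ s * 2 ^ s by rw [← mul_pow]; norm_num, mul_assoc ((-1) ^ s),
    mul_comm (2 ^ s), mul_assoc, ← hweight, ← intervalIntegral.integral_const_mul,
    jacobiFunctional_apply]
  refine intervalIntegral.integral_congr fun x hx => ?_
  rw [Set.uIcc_of_le (by norm_num)] at hx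
  have hpow : (1 - x) ^ (α + s) = (1 - x) ^ α * (1 - x) ^ s := by
    rcases Nat.eq_zero_or_pos s with rfl | hs
    · simp
    · have hs : (1 : ℝ) ≤ s := by exact_mod_cast hs
      rw [Real.rpow_add' (sub_nonneg.mpr hx.2) (by linarith), Real.rpow_natCast]
  simp only [eval_pow, eval_sub, eval_one, eval_X, hpow]
  rw [show x - 1 = -1 * (1 - x) by ring, mul_pow]
  ring

/-! ### Jacobi polynomials -/

/-- The `i`-th Taylor coefficient at `1` of the Jacobi polynomial of degree `n`. -/
noncomputable def jacobiTaylor (α β : ℝ) (n i : ℕ) : ℝ :=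
  (n.choose i : ℝ) * (ascPochhammer ℝ i).eval ((n : ℝ) + α + β + 1) *
    (ascPochhammer ℝ (n - i)).eval (α + (i : ℝ) + 1) / (n.factorial : ℝ) / 2 ^ i

theorem jacobiTaylor_of_lt (α β : ℝ) {n i : ℕ} (h : n < i) : jacobiTaylor α β n i = 0 := by
  simp [jacobiTaylor, Nat.choose_eq_zero_of_lt h]

theorem jacobiTaylor_pos (hα : -1 < α) (hβ : -1 < β) {n i : ℕ} (h : i ≤ n) :
    0 < jacobiTaylor α β n i := by
  have hleft : 0 < (ascPochhammer ℝ i).eval ((n : ℝ) + α + β + 1) := by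
    rcases Nat.eq_zero_or_pos i with rfl | hi
    · simp
    · have hn : (1 : ℝ) ≤ n := by exact_mod_cast hi.trans_le h
      exact ascPochhammer_pos _ _ (by linarith)
  have hright : 0 < (ascPochhammer ℝ (n - i)).eval (α + (i : ℝ) + 1) :=
    ascPochhammer_pos _ _ (by linarith [i.cast_nonneg (α := ℝ)])
  have hchoose : (0 : ℝ) < n.choose i := Nat.cast_pos.mpr (Nat.choose_pos h)
  rw [jacobiTaylor]
  positivity

theorem jacobiTaylor_nonneg (hα : -1 < α) (hβ : -1 < β) (n i : ℕ) : 0 ≤ jacobiTaylor α β n i := by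
  rcases lt_or_ge n i with h | h
  · exact (jacobiTaylor_of_lt α β h).ge
  · exact (jacobiTaylor_pos hα hβ h).le

theorem jacobiPoly_eq_sum (α β : ℝ) (n : ℕ) :
    jacobiPoly α β n = ∑ k ∈ Finset.range (n + 1), C (jacobiTaylor α β n k) * (X - 1) ^ k := by
  refine Finset.sum_congr rfl fun k _ => ?_
  rw [mul_pow, ← mul_assoc, ← C_pow, ← C_mul, one_div_pow, mul_one_div]
  rfl

theorem taylor_jacobiPoly_coeff (α β : ℝ) (n i : ℕ) :
    (taylor 1 (jacobiPoly α β n)).coeff i = jacobiTaylor α β n i := by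
  have htaylor : taylor 1 (jacobiPoly α β n) =
      ∑ k ∈ Finset.range (n + 1), C (jacobiTaylor α β n k) * X ^ k := by
    simp [jacobiPoly_eq_sum, taylor_mul, taylor_pow]
  rw [htaylor, finsetSum_coeff]
  simp only [coeff_C_mul, coeff_X_pow, mul_ite, mul_one, mul_zero, Finset.sum_ite_eq,
    Finset.mem_range]
  split_ifs with hi
  · rfl
  · exact (jacobiTaylor_of_lt α β (by omega)).symm

theorem degree_jacobiPoly (hα : -1 < α) (hβ : -1 < β) (n : ℕ) :
    (jacobiPoly α β n).degree = n := by
  rw [← degree_taylor _ (1 : ℝ)]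
  refine degree_eq_of_le_of_coeff_ne_zero ((degree_le_iff_coeff_zero _ _).mpr fun i hi => ?_) ?_
  · rw [taylor_jacobiPoly_coeff]
    exact jacobiTaylor_of_lt α β (by exact_mod_cast hi)
  · rw [taylor_jacobiPoly_coeff]
    exact (jacobiTaylor_pos hα hβ le_rfl).ne'

/-- The Jacobi polynomials as a sequence of polynomials indexed by their degrees. -/
noncomputable def jacobiSequence (hα : -1 < α) (hβ : -1 < β) : Polynomial.Sequence ℝ :=
  ⟨jacobiPoly α β, degree_jacobiPoly hα hβ⟩

theorem jacobiSequence_apply (hα : -1 < α) (hβ : -1 < β) (n : ℕ) :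
    jacobiSequence hα hβ n = jacobiPoly α β n := rfl

theorem jacobiTaylor_mul_moment (hα : -1 < α) (hβ : -1 < β) {n s k : ℕ} (hn : 1 ≤ n) (hs : s ≤ n)
    (hk : k ≤ n) :
    jacobiTaylor α β n k * 2 ^ k *
        (Real.Gamma (α + (s + k : ℕ) + 1) / Real.Gamma (α + β + (s + k : ℕ) + 2)) =
      Real.Gamma (α + n + 1) / (n.factorial * Real.Gamma (n + α + β + 1)) *
        (n.choose k * ((ascPochhammer ℝ s).eval (k + α + 1) *
          (ascPochhammer ℝ (n - s)).eval (k + α + β + s + 2) / (n + α + β + 1 + k))) := by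
  have hn' : (1 : ℝ) ≤ n := by exact_mod_cast hn
  have : (0 : ℝ) ≤ s := s.cast_nonneg
  have : (0 : ℝ) ≤ k := k.cast_nonneg
  have hc : 0 < (n : ℝ) + α + β + 1 := by linarith
  have ha : 0 < (k : ℝ) + α + 1 := by linarith
  have hb : 0 < (k : ℝ) + α + β + s + 2 := by linarith
  have hck : 0 < (n : ℝ) + α + β + 1 + k := by linarith
  have hΓc := Gamma_add_natCast hc k
  have hΓa := Gamma_add_natCast ha (n - k)
  have hΓs := Gamma_add_natCast ha s
  have hΓb := Gamma_add_natCast hb (n - s)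
  rw [Nat.cast_sub hk, show (k : ℝ) + α + 1 + (n - k) = α + n + 1 by ring] at hΓa
  rw [Nat.cast_sub hs, show (k : ℝ) + α + β + s + 2 + (n - s) = n + α + β + 1 + k + 1 by ring,
    Real.Gamma_add_one hck.ne', hΓc] at hΓb
  have := Real.Gamma_pos_of_pos ha
  have := Real.Gamma_pos_of_pos hb
  have := Real.Gamma_pos_of_pos hc
  rw [jacobiTaylor, hΓa, show α + (s + k : ℕ) + 1 = k + α + 1 + s by push_cast; ring, hΓs,
    show α + β + (s + k : ℕ) + 2 = k + α + β + s + 2 by push_cast; ring,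
    show α + (k : ℝ) + 1 = k + α + 1 by ring]
  field_simp
  linear_combination (n.choose k : ℝ) * (ascPochhammer ℝ (n - k)).eval (k + α + 1) *
    (ascPochhammer ℝ s).eval (k + α + 1) * hΓb

theorem jacobiFunctional_jacobiPoly_mul_X_sub_one_pow (hα : -1 < α) (hβ : -1 < β) {n s : ℕ}
    (hn : 1 ≤ n) (hs : s ≤ n) :
    jacobiFunctional hα hβ (jacobiPoly α β n * (X - 1) ^ s) =
      (-2) ^ s * 2 ^ (α + β + 1) * Real.Gamma (β + 1) * Real.Gamma (α + n + 1) /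
        Real.Gamma (2 * n + α + β + 2) *
      ((ascPochhammer ℝ s).eval (-(β + n)) *
        (ascPochhammer ℝ (n - s)).eval (s + 1 - n : ℝ)) := by
  have hn' : (1 : ℝ) ≤ n := by exact_mod_cast hn
  have hc : 0 < (n : ℝ) + α + β + 1 := by linarith
  set p : ℝ[X] := (ascPochhammer ℝ s).comp (X + C (α + 1)) *
    (ascPochhammer ℝ (n - s)).comp (X + C (α + β + s + 2)) with hp
  have heval (x : ℝ) : p.eval x =
      (ascPochhammer ℝ s).eval (x + α + 1) *
        (ascPochhammer ℝ (n - s)).eval (x + α + β + s + 2) := by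
    simp [hp, add_assoc]
  have hdeg : p.natDegree ≤ n := by
    refine natDegree_mul_le.trans ?_
    rw [natDegree_comp, natDegree_comp, natDegree_X_add_C, natDegree_X_add_C,
      ascPochhammer_natDegree, ascPochhammer_natDegree]
    omega
  have hexpand : jacobiFunctional hα hβ (jacobiPoly α β n * (X - 1) ^ s) =
      (-2) ^ s * 2 ^ (α + β + 1) * Real.Gamma (β + 1) *
        (Real.Gamma (α + n + 1) / (n.factorial * Real.Gamma (n + α + β + 1))) *
      ∑ k ∈ Finset.range (n + 1), (-1) ^ k * (n.choose k : ℝ) *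
        (p.eval (k : ℝ) / (n + α + β + 1 + k)) := by
    rw [jacobiPoly_eq_sum, Finset.sum_mul, map_sum, Finset.mul_sum]
    refine Finset.sum_congr rfl fun k hk => ?_
    have hterm := jacobiTaylor_mul_moment hα hβ hn hs (Finset.mem_range_succ_iff.mp hk)
    rw [mul_assoc, ← pow_add, ← smul_eq_C_mul, map_smul, smul_eq_mul, add_comm k s,
      jacobiFunctional_X_sub_one_pow, heval, pow_add, neg_pow 2 k]
    linear_combination ((-2) ^ s * (-1) ^ k * 2 ^ (α + β + 1) * Real.Gamma (β + 1)) * hterm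
  have hΓ := Gamma_add_natCast hc (n + 1)
  have := Real.Gamma_pos_of_pos hc
  have := ascPochhammer_pos (n + 1) _ hc
  rw [show (n : ℝ) + α + β + 1 + (n + 1 : ℕ) = 2 * n + α + β + 2 by push_cast; ring] at hΓ
  rw [hexpand, sum_neg_one_pow_mul_choose_mul_eval_div hdeg hc, heval, hΓ,
    show -((n : ℝ) + α + β + 1) + α + 1 = -(β + n) by ring,
    show -((n : ℝ) + α + β + 1) + α + β + s + 2 = s + 1 - n by ring]
  field_simp

theorem jacobiFunctional_jacobiPoly_mul_X_sub_one_pow_of_lt (hα : -1 < α) (hβ : -1 < β) {n s : ℕ}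
    (hs : s < n) : jacobiFunctional hα hβ (jacobiPoly α β n * (X - 1) ^ s) = 0 := by
  have hroot : (ascPochhammer ℝ (n - s)).eval (s + 1 - n : ℝ) = 0 := by
    have h := ascPochhammer_eval_neg_coe_nat_of_lt (R := ℝ) (show n - (s + 1) < n - s by omega)
    rwa [Nat.cast_sub hs, neg_sub, Nat.cast_succ] at h
  rw [jacobiFunctional_jacobiPoly_mul_X_sub_one_pow hα hβ (by omega) hs.le, hroot, mul_zero,
    mul_zero]

theorem jacobiFunctional_jacobiPoly_mul (hα : -1 < α) (hβ : -1 < β) {n : ℕ} {p : ℝ[X]}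
    (hp : p.natDegree ≤ n) :
    jacobiFunctional hα hβ (jacobiPoly α β n * p) =
      (taylor 1 p).coeff n * jacobiFunctional hα hβ (jacobiPoly α β n * (X - 1) ^ n) := by
  have hexpand : p = ∑ s ∈ Finset.range (n + 1), (taylor 1 p).coeff s • (X - 1) ^ s := by
    conv_lhs => rw [← sum_taylor_eq p 1, sum_over_range' _ (by simp) (n + 1)
      (by rw [natDegree_taylor]; omega)]
    simp [smul_eq_C_mul]
  conv_lhs => rw [hexpand, Finset.mul_sum, map_sum, Finset.sum_range_succ]
  simp only [mul_smul_comm, map_smul, smul_eq_mul]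
  rw [add_eq_right]
  refine Finset.sum_eq_zero fun s hs => ?_
  rw [jacobiFunctional_jacobiPoly_mul_X_sub_one_pow_of_lt hα hβ (Finset.mem_range.mp hs), mul_zero]

theorem jacobiFunctional_jacobiPoly_mul_jacobiPoly_of_lt (hα : -1 < α) (hβ : -1 < β) {k n : ℕ}
    (hk : k < n) : jacobiFunctional hα hβ (jacobiPoly α β n * jacobiPoly α β k) = 0 := by
  have hdeg : (jacobiPoly α β k).natDegree = k := (jacobiSequence hα hβ).natDegree_eq k
  rw [jacobiFunctional_jacobiPoly_mul hα hβ (by omega), taylor_jacobiPoly_coeff,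
    jacobiTaylor_of_lt α β hk, zero_mul]

theorem pairwise_jacobiFunctional_mul_eq_zero (hα : -1 < α) (hβ : -1 < β) :
    Pairwise fun k l =>
      jacobiFunctional hα hβ (jacobiSequence hα hβ k * jacobiSequence hα hβ l) = 0 := by
  intro k l hkl
  rcases hkl.lt_or_gt with h | h
  · rw [mul_comm]
    exact jacobiFunctional_jacobiPoly_mul_jacobiPoly_of_lt hα hβ h
  · exact jacobiFunctional_jacobiPoly_mul_jacobiPoly_of_lt hα hβ h

/-- The squared norm of the Jacobi polynomial of degree `n` in the weighted `L²` space. -/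
noncomputable def jacobiNormSq (α β : ℝ) (n : ℕ) : ℝ :=
  ∫ x in (-1 : ℝ)..1, (jacobiPoly α β n).eval x ^ 2 * ((1 - x) ^ α * (1 + x) ^ β)

theorem jacobiFunctional_jacobiPoly_mul_self (hα : -1 < α) (hβ : -1 < β) (n : ℕ) :
    jacobiFunctional hα hβ (jacobiPoly α β n * jacobiPoly α β n) = jacobiNormSq α β n := by
  simp only [jacobiFunctional_apply, jacobiNormSq, eval_mul, sq]

theorem jacobiNormSq_eq (hα : -1 < α) (hβ : -1 < β) {n : ℕ} (hn : 1 ≤ n) :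
    jacobiNormSq α β n = 2 ^ (α + β + 1) * Real.Gamma (n + α + 1) * Real.Gamma (n + β + 1) /
      ((2 * n + α + β + 1) * n.factorial * Real.Gamma (n + α + β + 1)) := by
  have hn' : (1 : ℝ) ≤ n := by exact_mod_cast hn
  have hc : 0 < (n : ℝ) + α + β + 1 := by linarith
  have hc' : 2 * (n : ℝ) + α + β + 1 ≠ 0 := by linarith
  have hdeg : (jacobiPoly α β n).natDegree = n := (jacobiSequence hα hβ).natDegree_eq n
  have hneg : (-2) ^ n * (ascPochhammer ℝ n).eval (-(β + n)) =
      2 ^ n * (ascPochhammer ℝ n).eval (β + 1) := by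
    rw [ascPochhammer_eval_neg_eq_descPochhammer, descPochhammer_eval_eq_ascPochhammer,
      ← mul_assoc, ← mul_pow, show β + n - n + 1 = β + 1 by ring]
    norm_num
  have hΓβ := Gamma_add_natCast (show 0 < β + 1 by linarith) n
  have hΓc := Gamma_add_natCast hc n
  have hΓ := Real.Gamma_add_one hc'
  rw [show (n : ℝ) + α + β + 1 + n = 2 * n + α + β + 1 by ring] at hΓc
  rw [show 2 * (n : ℝ) + α + β + 1 + 1 = 2 * n + α + β + 2 by ring, hΓc] at hΓ
  have := Real.Gamma_pos_of_pos hc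
  have := ascPochhammer_pos n _ hc
  rw [← jacobiFunctional_jacobiPoly_mul_self hα hβ, jacobiFunctional_jacobiPoly_mul hα hβ hdeg.le,
    jacobiFunctional_jacobiPoly_mul_X_sub_one_pow hα hβ hn le_rfl, taylor_jacobiPoly_coeff,
    jacobiTaylor, hΓ, show (n : ℝ) + β + 1 = β + 1 + n by ring, hΓβ,
    show (n : ℝ) + α + 1 = α + n + 1 by ring]
  simp only [Nat.choose_self, Nat.sub_self, ascPochhammer_zero, eval_one, Nat.cast_one]
  field_simp
  linear_combination
    Real.Gamma (β + 1) * Real.Gamma (α + n + 1) / (2 * n + α + β + 1) * hneg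

theorem jacobiNormSq_pos (hα : -1 < α) (hβ : -1 < β) (n : ℕ) : 0 < jacobiNormSq α β n := by
  rcases Nat.eq_zero_or_pos n with rfl | hn
  · simpa [jacobiNormSq, jacobiPoly] using integral_jacobi_weight_pos hα hβ
  · have hn' : (1 : ℝ) ≤ n := by exact_mod_cast hn
    have := Real.Gamma_pos_of_pos (show 0 < n + α + 1 by linarith)
    have := Real.Gamma_pos_of_pos (show 0 < n + β + 1 by linarith)
    have := Real.Gamma_pos_of_pos (show 0 < (n : ℝ) + α + β + 1 by linarith)
    have : 0 < 2 * (n : ℝ) + α + β + 1 := by linarith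
    rw [jacobiNormSq_eq hα hβ hn]
    positivity

/-! ### Jacobi–Sobolev polynomials -/

/-- The functional `f ↦ f⁽ʲ⁾(1)` of the discrete part of the Sobolev inner product. -/
noncomputable def derivativeAtOne (j : ℕ) : ℝ[X] →ₗ[ℝ] ℝ :=
  leval 1 ∘ₗ derivative ^ j

theorem derivativeAtOne_eq (j : ℕ) (p : ℝ[X]) :
    derivativeAtOne j p = j.factorial * (taylor 1 p).coeff j := by
  rw [taylor_coeff, derivativeAtOne, LinearMap.comp_apply, Module.End.pow_apply,
    ← factorial_smul_hasseDeriv]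
  simp

theorem sobolevInner_eq (hα : -1 < α) (hβ : -1 < β) (j : ℕ) (m : ℝ) (f g : ℝ[X]) :
    sobolevInner α β j m f g =
      jacobiFunctional hα hβ (f * g) + m * derivativeAtOne j f * derivativeAtOne j g := by
  simp only [sobolevInner, jacobiFunctional_apply, derivativeAtOne, eval_mul, mul_assoc,
    LinearMap.comp_apply, Module.End.pow_apply, leval_apply]

theorem degree_sub_jacobiPoly_lt (hα : -1 < α) (hβ : -1 < β) {j n : ℕ} {m : ℝ} {Q : ℝ[X]}
    (hQ : IsJacobiSobolev α β j m n Q) : (Q - jacobiPoly α β n).degree < n := by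
  have hP := degree_jacobiPoly hα hβ n
  have hQ₀ : Q ≠ 0 := by
    rw [← leadingCoeff_ne_zero, hQ.leadingCoeff_eq, leadingCoeff_ne_zero]
    exact (jacobiSequence hα hβ).ne_zero n
  have hdeg : Q.degree = n := by rw [degree_eq_natDegree hQ₀, hQ.natDegree_eq]
  exact hdeg ▸ degree_sub_lt_left (hdeg.trans hP.symm) hQ₀ hQ.leadingCoeff_eq

/-- The `i`-th Taylor coefficient at `x = 1` of `j! ∂_y^j K_{n-1}(x, y)` at `y = 1`, where
`K_{n-1}` is the Christoffel–Darboux kernel of the Jacobi weight. With the factor `j!` the `j`-th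
coefficient is the mixed derivative `∂_x^j ∂_y^j K_{n-1}(1, 1)`. -/
noncomputable def kernelTaylor (α β : ℝ) (j n i : ℕ) : ℝ :=
  ∑ k ∈ Finset.range n,
    (j.factorial : ℝ) ^ 2 * jacobiTaylor α β k j / jacobiNormSq α β k * jacobiTaylor α β k i

theorem taylor_kernelPoly_coeff (hα : -1 < α) (hβ : -1 < β) (j n i : ℕ) :
    j.factorial * (taylor 1 (kernelPoly (jacobiFunctional hα hβ) (jacobiSequence hα hβ)
      (derivativeAtOne j) n)).coeff i = kernelTaylor α β j n i := by
  simp only [kernelPoly, kernelTaylor, map_sum, map_smul, finsetSum_coeff, coeff_smul,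
    jacobiSequence_apply, jacobiFunctional_jacobiPoly_mul_self, derivativeAtOne_eq,
    taylor_jacobiPoly_coeff, Finset.mul_sum, smul_eq_mul]
  exact Finset.sum_congr rfl fun k _ => by ring

theorem taylor_coeff_of_isJacobiSobolev (hα : -1 < α) (hβ : -1 < β) {j n : ℕ} {m : ℝ}
    {Q : ℝ[X]} (hQ : IsJacobiSobolev α β j m n Q) (i : ℕ) :
    (taylor 1 Q).coeff i =
      jacobiTaylor α β n i - m * (taylor 1 Q).coeff j * kernelTaylor α β j n i := by
  have horth : ∀ k < n, jacobiFunctional hα hβ (Q * jacobiSequence hα hβ k) +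
      m * derivativeAtOne j Q * derivativeAtOne j (jacobiSequence hα hβ k) = 0 := fun k hk => by
    rw [← sobolevInner_eq hα hβ]
    exact hQ.orthogonal _ (by rw [Sequence.degree_eq]; exact_mod_cast hk)
  have hexpand := eq_sub_smul_kernelPoly (pairwise_jacobiFunctional_mul_eq_zero hα hβ)
    (fun k => (jacobiFunctional_jacobiPoly_mul_self hα hβ k).trans_ne
      (jacobiNormSq_pos hα hβ k).ne')
    (degree_sub_jacobiPoly_lt hα hβ hQ) horth
  have hcoeff := congrArg (fun p => (taylor 1 p).coeff i) hexpand
  simp only [map_sub, map_smul, coeff_sub, coeff_smul, smul_eq_mul, derivativeAtOne_eq,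
    jacobiSequence_apply, taylor_jacobiPoly_coeff] at hcoeff
  rw [← taylor_kernelPoly_coeff hα hβ]
  linear_combination hcoeff

/-! ### Asymptotics of Taylor coefficients -/

theorem criticalMass_pos (hα : -1 < α) (β : ℝ) (j : ℕ) : 0 < criticalMass α β j := by
  have : (0 : ℝ) ≤ j := j.cast_nonneg
  have := Real.Gamma_pos_of_pos (show 0 < α + j + 1 by linarith)
  have : 0 < α + 2 * j + 1 := by linarith
  rw [criticalMass]
  positivity

/-- The limit of the `i`-th Taylor coefficient at `1` of the Jacobi polynomial of degree `n`,
divided by `n ^ (α + 2 * i)`. -/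
noncomputable def taylorLimit (α : ℝ) (i : ℕ) : ℝ :=
  1 / (i.factorial * 2 ^ i * Real.Gamma (α + i + 1))

theorem taylorLimit_pos (hα : -1 < α) (i : ℕ) : 0 < taylorLimit α i := by
  have := Real.Gamma_pos_of_pos (show 0 < α + i + 1 by linarith [i.cast_nonneg (α := ℝ)])
  rw [taylorLimit]
  positivity

theorem jacobiTaylor_eq_Gamma (hα : -1 < α) (β : ℝ) (n i : ℕ) :
    jacobiTaylor α β n i = n.choose i * (ascPochhammer ℝ i).eval (n + (α + β + 1)) *
      (Real.Gamma (n + α + 1) / n.factorial) / (2 ^ i * Real.Gamma (α + i + 1)) := by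
  rcases lt_or_ge n i with h | h
  · simp [jacobiTaylor_of_lt, Nat.choose_eq_zero_of_lt, h]
  · have hpos : 0 < α + i + 1 := by linarith [i.cast_nonneg (α := ℝ)]
    have hΓ := Gamma_add_natCast hpos (n - i)
    have := Real.Gamma_pos_of_pos hpos
    rw [Nat.cast_sub h, show α + i + 1 + (n - i) = (n : ℝ) + α + 1 by ring] at hΓ
    rw [jacobiTaylor, hΓ, ← add_assoc, ← add_assoc]
    field_simp

theorem isEquivalent_jacobiTaylor (hα : -1 < α) (β : ℝ) (i : ℕ) :
    (fun n => jacobiTaylor α β n i) ~[atTop] fun n => taylorLimit α i * (n : ℝ) ^ (α + 2 * i) := by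
  have hequiv := (((isEquivalent_choose i).mul
    (isEquivalent_ascPochhammer_eval_natCast_add (α + β + 1) i)).mul
    ((isEquivalent_Gamma_natCast_add α).div (.refl (u := fun n : ℕ => (n.factorial : ℝ))))).div
    (.refl (u := fun _ : ℕ => 2 ^ i * Real.Gamma (α + i + 1)))
  refine (hequiv.congr_left (.of_forall fun n => ?_)).congr_right ?_
  · exact (jacobiTaylor_eq_Gamma hα β n i).symm
  · filter_upwards [eventually_gt_atTop 0] with n hn
    have hn' : (0 : ℝ) < n := by exact_mod_cast hn
    have hpow : (n : ℝ) ^ (α + 2 * i) = n ^ α * n ^ i * n ^ i := by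
      rw [two_mul, ← add_assoc, Real.rpow_add hn', Real.rpow_add hn', Real.rpow_natCast]
    simp only [Pi.mul_apply, Pi.div_apply, hpow, taylorLimit]
    field_simp

theorem isEquivalent_jacobiNormSq (hα : -1 < α) (hβ : -1 < β) :
    jacobiNormSq α β ~[atTop] fun n => 2 ^ (α + β) * (n : ℝ)⁻¹ := by
  have hfactorial : (fun n : ℕ => (n.factorial : ℝ)) ~[atTop] fun n => (n.factorial : ℝ) := .refl
  have hequiv := ((((Asymptotics.IsEquivalent.refl (u := fun _ : ℕ => (2 : ℝ) ^ (α + β))).mul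
    (isEquivalent_Gamma_natCast_add α)).mul (isEquivalent_Gamma_natCast_add β)).div
    (((isEquivalent_natCast_add ((α + β + 1) / 2)).mul hfactorial).mul
      (isEquivalent_Gamma_natCast_add (α + β))))
  refine (hequiv.congr_left ?_).congr_right ?_
  · filter_upwards [eventually_ge_atTop 1] with n hn
    simp only [Pi.mul_apply, Pi.div_apply]
    rw [jacobiNormSq_eq hα hβ hn, Real.rpow_add_one two_ne_zero,
      show 2 * (n : ℝ) + α + β + 1 = 2 * (n + (α + β + 1) / 2) by ring, add_assoc (n : ℝ) α β]
    field_simp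
  · filter_upwards [eventually_gt_atTop 0] with n hn
    have hn' : (0 : ℝ) < n := by exact_mod_cast hn
    simp only [Pi.mul_apply, Pi.div_apply, Real.rpow_add hn']
    field_simp

/-- The limit of `kernelTaylor α β j n i / n ^ (2 * (α + i + j + 1))`. -/
noncomputable def kernelLimit (α β : ℝ) (j i : ℕ) : ℝ :=
  (j.factorial : ℝ) ^ 2 * taylorLimit α j / 2 ^ (α + β) * taylorLimit α i / (2 * (α + i + j + 1))

theorem isEquivalent_kernelTaylor (hα : -1 < α) (hβ : -1 < β) (j i : ℕ) :
    (fun n => kernelTaylor α β j n i) ~[atTop]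
      fun n => kernelLimit α β j i * (n : ℝ) ^ (2 * (α + i + j + 1)) := by
  have hq : 0 < 2 * (α + i + j + 1) := by
    linarith [i.cast_nonneg (α := ℝ), j.cast_nonneg (α := ℝ)]
  have := taylorLimit_pos hα i
  have := taylorLimit_pos hα j
  refine isEquivalent_sum_range_of_rpow (by positivity) hq ?_
  have hequiv := (((Asymptotics.IsEquivalent.refl (u := fun _ : ℕ => (j.factorial : ℝ) ^ 2)).mul
    (isEquivalent_jacobiTaylor hα β j)).div (isEquivalent_jacobiNormSq hα hβ)).mul
    (isEquivalent_jacobiTaylor hα β i)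
  refine hequiv.congr_right ?_
  filter_upwards [eventually_gt_atTop 0] with n hn
  have hn' : (0 : ℝ) < n := by exact_mod_cast hn
  have hpow : (n : ℝ) ^ (2 * (α + i + j + 1) - 1) = n ^ (α + 2 * j) * n ^ (α + 2 * i) * n := by
    rw [← Real.rpow_add hn', ← Real.rpow_add_one hn'.ne']
    ring_nf
  simp only [Pi.mul_apply, Pi.div_apply, hpow]
  field_simp

theorem taylorLimit_mul_kernelLimit (hα : -1 < α) (β : ℝ) (j i : ℕ) :
    taylorLimit α j * kernelLimit α β j i =
      taylorLimit α i * ((α + 2 * j + 1) / (criticalMass α β j * (α + j + i + 1))) := by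
  have : (0 : ℝ) ≤ i := i.cast_nonneg
  have : (0 : ℝ) ≤ j := j.cast_nonneg
  have := Real.Gamma_pos_of_pos (show 0 < α + j + 1 by linarith)
  have : 0 < α + j * 2 + 1 := by linarith
  have : 0 < α + j + i + 1 := by linarith
  have hpow : (2 : ℝ) ^ (α + β + 2 * j + 1) = 2 ^ (α + β) * (2 ^ j) ^ 2 * 2 := by
    rw [Real.rpow_add_one two_ne_zero, Real.rpow_add two_pos, mul_comm 2 (j : ℝ),
      Real.rpow_mul two_pos.le, Real.rpow_natCast, Real.rpow_ofNat]
  rw [kernelLimit, criticalMass, hpow, show α + i + j + 1 = α + j + i + 1 by ring,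
    mul_comm 2 (j : ℝ), taylorLimit.eq_def α j]
  field_simp

theorem kernelLimit_self (hα : -1 < α) (β : ℝ) (j : ℕ) :
    kernelLimit α β j j = 1 / criticalMass α β j := by
  have hpos : 0 < α + 2 * j + 1 := by linarith [j.cast_nonneg (α := ℝ)]
  have hprod := mul_left_cancel₀ (taylorLimit_pos hα j).ne' (taylorLimit_mul_kernelLimit hα β j j)
  rw [hprod, show α + j + j + 1 = α + 2 * j + 1 by ring]
  field_simp

/-! ### Uniform bounds and the effective mass -/

/-- A bound, uniform in `n`, of the `i`-th Taylor coefficient at `1` of the Jacobi polynomial of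
degree `n` relative to its constant one, in units of `n ^ (2 * i)`. -/
noncomputable def taylorMajorant (α β : ℝ) (i : ℕ) : ℝ :=
  ((2 + |α + β + 1|) / (2 * (α + 1))) ^ i / i.factorial

theorem taylorMajorant_nonneg (hα : -1 < α) (β : ℝ) (i : ℕ) : 0 ≤ taylorMajorant α β i := by
  have : 0 < α + 1 := by linarith
  rw [taylorMajorant]
  positivity

theorem summable_taylorMajorant_mul_pow (α β x : ℝ) :
    Summable fun i => taylorMajorant α β i * x ^ i := by
  refine (Real.summable_pow_div_factorial ((2 + |α + β + 1|) / (2 * (α + 1)) * x)).congr fun i => ?_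
  rw [taylorMajorant, mul_pow, mul_div_right_comm]

theorem jacobiTaylor_le (hα : -1 < α) (hβ : -1 < β) (n i : ℕ) :
    jacobiTaylor α β n i ≤ jacobiTaylor α β n 0 * (taylorMajorant α β i * (n : ℝ) ^ (2 * i)) := by
  have hE := taylorMajorant_nonneg hα β i
  rcases lt_or_ge n i with h | h
  · rw [jacobiTaylor_of_lt α β h]
    exact mul_nonneg (jacobiTaylor_nonneg hα hβ n 0) (by positivity)
  rcases Nat.eq_zero_or_pos n with rfl | hn
  · simp [taylorMajorant, Nat.le_zero.mp h]
  have hn' : (1 : ℝ) ≤ n := by exact_mod_cast hn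
  have hpos : 0 < α + 1 := by linarith
  have hx : 0 < (n : ℝ) + (α + β + 1) := by linarith
  have hpoch : (ascPochhammer ℝ i).eval ((n : ℝ) + (α + β + 1)) ≤ ((2 + |α + β + 1|) * n) ^ i := by
    refine (ascPochhammer_eval_le_pow hx.le i).trans ?_
    have hin : (i : ℝ) ≤ n := by exact_mod_cast h
    have habs := le_mul_of_one_le_right (abs_nonneg (α + β + 1)) hn'
    gcongr
    linarith [le_abs_self (α + β + 1)]
  have hΓ : (α + 1) ^ i * Real.Gamma (α + 1) ≤ Real.Gamma (α + i + 1) := by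
    rw [add_right_comm, Gamma_add_natCast hpos]
    gcongr
    exact pow_le_ascPochhammer_eval hpos.le i
  have := Real.Gamma_pos_of_pos hpos
  have := Real.Gamma_pos_of_pos (show 0 < (n : ℝ) + α + 1 by linarith)
  have := (ascPochhammer_pos i _ hx).le
  calc jacobiTaylor α β n i
      ≤ (n : ℝ) ^ i / i.factorial * ((2 + |α + β + 1|) * n) ^ i *
          (Real.Gamma (n + α + 1) / n.factorial) /
          (2 ^ i * ((α + 1) ^ i * Real.Gamma (α + 1))) := by
        rw [jacobiTaylor_eq_Gamma hα]
        gcongr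
        exact Nat.choose_le_pow_div i n
    _ = jacobiTaylor α β n 0 * (taylorMajorant α β i * (n : ℝ) ^ (2 * i)) := by
        rw [jacobiTaylor_eq_Gamma hα, taylorMajorant]
        simp only [Nat.choose_zero_right, ascPochhammer_zero, eval_one, Nat.cast_one,
          Nat.cast_zero, add_zero, pow_zero, one_mul, mul_pow, div_pow, pow_mul']
        field_simp

theorem kernelTaylor_nonneg (hα : -1 < α) (hβ : -1 < β) (j n i : ℕ) :
    0 ≤ kernelTaylor α β j n i := by
  refine Finset.sum_nonneg fun k _ => ?_
  have := jacobiTaylor_nonneg hα hβ k i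
  have := jacobiTaylor_nonneg hα hβ k j
  have := jacobiNormSq_pos hα hβ k
  positivity

theorem kernelTaylor_le (hα : -1 < α) (hβ : -1 < β) (j n i : ℕ) :
    kernelTaylor α β j n i ≤
      kernelTaylor α β j n 0 * (taylorMajorant α β i * (n : ℝ) ^ (2 * i)) := by
  rw [kernelTaylor, kernelTaylor, Finset.sum_mul]
  refine Finset.sum_le_sum fun k hk => ?_
  have hkn : (k : ℝ) ≤ n := by exact_mod_cast (Finset.mem_range.mp hk).le
  have := jacobiTaylor_nonneg hα hβ k 0
  have := jacobiTaylor_nonneg hα hβ k j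
  have := jacobiNormSq_pos hα hβ k
  have := taylorMajorant_nonneg hα β i
  rw [mul_assoc]
  gcongr
  refine (jacobiTaylor_le hα hβ k i).trans ?_
  gcongr

/-- The mass `m / (1 + m K)`, where `K` is the mixed derivative `∂_x^j ∂_y^j K_{n-1}(1, 1)` of the
Christoffel–Darboux kernel: replacing `m` by it makes up for replacing the unknown
`Q_n⁽ʲ⁾(1)` by the `j`-th derivative of the Jacobi polynomial in the expansion of `Q_n`. -/
noncomputable def effectiveMass (α β : ℝ) (j : ℕ) (m : ℝ) (n : ℕ) : ℝ :=
  m / (1 + m * kernelTaylor α β j n j)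

/-- The `i`-th Taylor coefficient at `1` of the Jacobi–Sobolev polynomial with effective mass `e`: a
rank-one perturbation of the one of the Jacobi polynomial. -/
noncomputable def sobolevTaylor (α β : ℝ) (j : ℕ) (e : ℝ) (n i : ℕ) : ℝ :=
  jacobiTaylor α β n i - e * jacobiTaylor α β n j * kernelTaylor α β j n i

theorem taylor_coeff_eq_sobolevTaylor (hα : -1 < α) (hβ : -1 < β) {j n : ℕ} {m : ℝ} {Q : ℝ[X]}
    (hQ : IsJacobiSobolev α β j m n Q) (hjn : j ≤ n) (i : ℕ) :
    (taylor 1 Q).coeff i = sobolevTaylor α β j (effectiveMass α β j m n) n i := by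
  have hj : (taylor 1 Q).coeff j * (1 + m * kernelTaylor α β j n j) = jacobiTaylor α β n j := by
    linear_combination taylor_coeff_of_isJacobiSobolev hα hβ hQ j
  have hne : 1 + m * kernelTaylor α β j n j ≠ 0 :=
    right_ne_zero_of_mul (hj.trans_ne (jacobiTaylor_pos hα hβ hjn).ne')
  rw [taylor_coeff_of_isJacobiSobolev hα hβ hQ i, sobolevTaylor, effectiveMass, ← hj]
  field_simp

theorem tendsto_kernelTaylor_self_div (hα : -1 < α) (hβ : -1 < β) (j : ℕ) :
    Tendsto (fun n : ℕ => kernelTaylor α β j n j / (n : ℝ) ^ (2 * (α + 2 * j + 1))) atTop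
      (𝓝 (criticalMass α β j)⁻¹) := by
  have hequiv := isEquivalent_kernelTaylor hα hβ j j
  rw [kernelLimit_self hα, one_div, show α + j + j + 1 = α + 2 * j + 1 by ring] at hequiv
  refine tendsto_div_of_isEquivalent_const_mul hequiv ?_
  filter_upwards [eventually_gt_atTop 0] with n hn
  positivity

theorem tendsto_effectiveMass_mul_rpow (hα : -1 < α) (hβ : -1 < β) {j : ℕ} {m : ℕ → ℝ} {t : ℝ}
    (hm : Tendsto (fun n => m n * (n : ℝ) ^ (2 * (α + 2 * j + 1))) atTop (𝓝 t))
    (ht : t + criticalMass α β j ≠ 0) :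
    Tendsto (fun n => effectiveMass α β j (m n) n * (n : ℝ) ^ (2 * (α + 2 * j + 1))) atTop
      (𝓝 (t / (t + criticalMass α β j) * criticalMass α β j)) := by
  have hc := criticalMass_pos hα β j
  have hlim : 1 + t * (criticalMass α β j)⁻¹ = (t + criticalMass α β j) / criticalMass α β j := by
    field_simp
    ring
  have hquot := hm.div ((hm.mul (tendsto_kernelTaylor_self_div hα hβ j)).const_add 1)
    (hlim.trans_ne (div_ne_zero ht hc.ne'))
  rw [hlim, div_div_eq_mul_div, mul_div_right_comm] at hquot
  refine hquot.congr' ?_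
  filter_upwards [eventually_gt_atTop 0] with n hn
  have : 0 < (n : ℝ) ^ (2 * (α + 2 * j + 1)) := by positivity
  rw [Pi.div_apply, effectiveMass]
  field_simp

theorem tendsto_effectiveMass_mul_rpow_of_abs_atTop (hα : -1 < α) (hβ : -1 < β) {j : ℕ}
    {m : ℕ → ℝ}
    (hm : Tendsto (fun n => |m n * (n : ℝ) ^ (2 * (α + 2 * j + 1))|) atTop atTop) :
    Tendsto (fun n => effectiveMass α β j (m n) n * (n : ℝ) ^ (2 * (α + 2 * j + 1))) atTop
      (𝓝 (criticalMass α β j)) := by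
  have hc := criticalMass_pos hα β j
  have hinv : Tendsto (fun n => (m n * (n : ℝ) ^ (2 * (α + 2 * j + 1)))⁻¹) atTop (𝓝 0) :=
    (tendsto_zero_iff_abs_tendsto_zero _).mpr
      (hm.inv_tendsto_atTop.congr fun n => (abs_inv _).symm)
  have hquot := (hinv.add (tendsto_kernelTaylor_self_div hα hβ j)).inv₀ (by positivity)
  rw [zero_add, inv_inv] at hquot
  refine hquot.congr' ?_
  filter_upwards [hm.eventually_gt_atTop 0] with n hn
  have hpos := abs_pos.mp hn
  have := left_ne_zero_of_mul hpos
  have := right_ne_zero_of_mul hpos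
  rw [effectiveMass, div_mul_eq_mul_div, ← inv_div]
  field_simp

/-! ### Bessel expansions of the limit functions -/

/-- The coefficient of `(-z² / 2) ^ s` in `2 ^ i (z/2)^{-α} J_{α+2i}(z)`, relative to the same
coefficient for `i = 0`; it is also the coefficient of `b_i` in the recursion for `b`. -/
noncomputable def besselMultiplier (α : ℝ) (i s : ℕ) : ℝ :=
  (-2) ^ i * s.descFactorial i / (ascPochhammer ℝ i).eval (α + s + 1)

theorem besselMultiplier_eq_Gamma (hα : -1 < α) (i s : ℕ) :
    besselMultiplier α i s = Real.Gamma (α + s + 1) *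
      (s.choose i * ((-1) ^ i * i.factorial * 2 ^ i) / Real.Gamma (α + s + i + 1)) := by
  have hpos : 0 < α + s + 1 := by linarith [s.cast_nonneg (α := ℝ)]
  have := Real.Gamma_pos_of_pos hpos
  rw [besselMultiplier, add_right_comm _ (i : ℝ), Gamma_add_natCast hpos,
    Nat.descFactorial_eq_factorial_mul_choose, neg_pow, Nat.cast_mul]
  field_simp

theorem sum_besselCoeff_mul_besselMultiplier (hα : -1 < α) (r : ℕ → ℝ) (s : ℕ) :
    ∑ i ∈ Finset.range (s + 1), besselCoeff α r i * besselMultiplier α i s = r s := by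
  have hsum : ∑ i ∈ Finset.range s, besselCoeff α r i * besselMultiplier α i s =
      Real.Gamma (α + s + 1) * ∑ i ∈ Finset.range s, besselCoeff α r i * s.choose i *
        ((-1) ^ i * i.factorial * 2 ^ i) / Real.Gamma (α + s + i + 1) := by
    rw [Finset.mul_sum]
    refine Finset.sum_congr rfl fun i _ => ?_
    rw [besselMultiplier_eq_Gamma hα]
    ring
  have hrec : besselCoeff α r s * besselMultiplier α s s = r s -
      ∑ i ∈ Finset.range s, besselCoeff α r i * besselMultiplier α i s := by
    have := Real.Gamma_pos_of_pos (show 0 < α + s + 1 by linarith [s.cast_nonneg (α := ℝ)])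
    have hΓ := Real.Gamma_pos_of_pos (show 0 < α + 2 * s + 1 by linarith [s.cast_nonneg (α := ℝ)])
    rw [besselCoeff, hsum, besselMultiplier_eq_Gamma hα, Nat.choose_self, Nat.cast_one,
      show α + s + s + 1 = α + 2 * s + 1 by ring,
      Fin.sum_univ_eq_sum_range (fun i => besselCoeff α r i * s.choose i *
        ((-1) ^ i * i.factorial * 2 ^ i) / Real.Gamma (α + s + i + 1))]
    generalize Real.Gamma (α + 2 * s + 1) = G at hΓ ⊢
    rcases neg_one_pow_eq_or ℝ s with hs | hs <;> rw [hs] <;> field_simp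
  rw [Finset.sum_range_succ, hrec, add_sub_cancel]

theorem exists_natDegree_le_eval_eq_besselMultiplier_mul (hα : -1 < α) {i N : ℕ} (hi : i ≤ N) :
    ∃ p : ℝ[X], p.natDegree ≤ N ∧ ∀ s : ℕ,
      p.eval (s : ℝ) = besselMultiplier α i s * (ascPochhammer ℝ N).eval (α + s + 1) := by
  refine ⟨C ((-2) ^ i) * (descPochhammer ℝ i * (ascPochhammer ℝ (N - i)).comp (X + C (α + 1 + i))),
    ?_, fun s => ?_⟩
  · refine (natDegree_C_mul_le _ _).trans (natDegree_mul_le.trans ?_)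
    rw [natDegree_comp, natDegree_X_add_C, ascPochhammer_natDegree, descPochhammer_natDegree]
    omega
  · have := ascPochhammer_pos i (α + s + 1) (by linarith [s.cast_nonneg (α := ℝ)])
    have hsplit := ascPochhammer_add_eval (α + s + 1) i (N - i)
    rw [Nat.add_sub_cancel' hi] at hsplit
    rw [hsplit, besselMultiplier, show α + s + 1 + i = s + (α + 1 + i) by ring]
    simp only [eval_mul, eval_C, eval_comp, eval_add, eval_X,
      descPochhammer_eval_eq_descFactorial]
    field_simp

/-- Both sides times `(α + s + 1)_N` are polynomials in `s` of degree at most `N`, and they agree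
for `s ≤ N`. -/
theorem sum_besselCoeff_mul_besselMultiplier_of_natDegree_le (hα : -1 < α) {r : ℕ → ℝ} {N : ℕ}
    {q : ℝ[X]} (hq : q.natDegree ≤ N)
    (hr : ∀ s : ℕ, q.eval (s : ℝ) = r s * (ascPochhammer ℝ N).eval (α + s + 1)) (s : ℕ) :
    ∑ i ∈ Finset.range (N + 1), besselCoeff α r i * besselMultiplier α i s = r s := by
  choose! p hp using fun i (hi : i ≤ N) =>
    exists_natDegree_le_eval_eq_besselMultiplier_mul hα hi
  set d : ℝ[X] := ∑ i ∈ Finset.range (N + 1), C (besselCoeff α r i) * p i - q with hd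
  have heval : ∀ s : ℕ, d.eval (s : ℝ) = (∑ i ∈ Finset.range (N + 1),
      besselCoeff α r i * besselMultiplier α i s - r s) *
        (ascPochhammer ℝ N).eval (α + s + 1) := fun s => by
    rw [hd, eval_sub, eval_finsetSum, hr, sub_mul, Finset.sum_mul]
    congr 1
    refine Finset.sum_congr rfl fun i hi => ?_
    rw [eval_mul, eval_C, (hp i (Finset.mem_range_succ_iff.mp hi)).2, mul_assoc]
  have hdeg : d.natDegree ≤ N := by
    refine natDegree_sub_le_of_le (natDegree_sum_le_of_forall_le _ _ fun i hi => ?_) hq |>.trans_eq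
      (max_self N)
    exact (natDegree_C_mul_le _ _).trans (hp i (Finset.mem_range_succ_iff.mp hi)).1
  have hroot : ∀ s ≤ N, d.eval (s : ℝ) = 0 := fun s hs => by
    rw [heval, ← sum_besselCoeff_mul_besselMultiplier hα r s, sub_eq_zero.mpr, zero_mul]
    refine (Finset.sum_subset (Finset.range_mono (by omega)) fun i _ hi => ?_).symm
    rw [besselMultiplier, Nat.descFactorial_of_lt (by simpa using hi)]
    simp
  have hzero : d = 0 :=
    eq_zero_of_natDegree_lt_card_of_eval_eq_zero d (f := fun i : Fin (N + 1) => ((i : ℕ) : ℝ))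
      (Nat.cast_injective.comp Fin.val_injective) (fun i => hroot i (by omega))
      (by simpa using Nat.lt_succ_of_le hdeg)
  have := ascPochhammer_pos N (α + s + 1) (by linarith [s.cast_nonneg (α := ℝ)])
  refine sub_eq_zero.mp (eq_zero_of_ne_zero_of_mul_right_eq_zero this.ne' ?_)
  rw [← heval, hzero, eval_zero]

theorem abs_besselMultiplier_le (hα : -1 < α) (i s : ℕ) : |besselMultiplier α i s| ≤ 2 ^ i := by
  have hpos : 0 < α + s + 1 := by linarith [s.cast_nonneg (α := ℝ)]
  have hpoch := ascPochhammer_pos i _ hpos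
  rw [besselMultiplier, abs_div, abs_mul, abs_pow, abs_neg, abs_two, Nat.abs_cast,
    abs_of_pos hpoch, div_le_iff₀ hpoch]
  gcongr
  calc (s.descFactorial i : ℝ) ≤ (s : ℝ) ^ i := by exact_mod_cast Nat.descFactorial_le_pow s i
    _ ≤ (α + s + 1) ^ i := by gcongr; linarith
    _ ≤ (ascPochhammer ℝ i).eval (α + s + 1) := pow_le_ascPochhammer_eval hpos.le i

theorem summable_taylorLimit_mul_pow (hα : -1 < α) (x : ℝ) :
    Summable fun s => taylorLimit α s * x ^ s := by
  have hpos : 0 < α + 1 := by linarith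
  have := Real.Gamma_pos_of_pos hpos
  refine .of_norm_bounded ((Real.summable_pow_div_factorial (|x| / (2 * (α + 1)))).mul_left
    (Real.Gamma (α + 1))⁻¹) fun s => ?_
  have := pow_le_ascPochhammer_eval hpos.le s
  rw [norm_mul, norm_pow, Real.norm_eq_abs, Real.norm_eq_abs, abs_of_pos (taylorLimit_pos hα s),
    taylorLimit, add_right_comm, Gamma_add_natCast hpos]
  calc 1 / (s.factorial * 2 ^ s * ((ascPochhammer ℝ s).eval (α + 1) * Real.Gamma (α + 1))) * |x| ^ s
      ≤ 1 / (s.factorial * 2 ^ s * ((α + 1) ^ s * Real.Gamma (α + 1))) * |x| ^ s := by gcongr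
    _ = (Real.Gamma (α + 1))⁻¹ * ((|x| / (2 * (α + 1))) ^ s / s.factorial) := by
      rw [div_pow, mul_pow]
      field_simp

theorem besselMultiplier_mul_taylorLimit_add (hα : -1 < α) (i k : ℕ) :
    besselMultiplier α i (k + i) * taylorLimit α (k + i) =
      (-2) ^ i * (1 / (k.factorial * 2 ^ (k + i) * Real.Gamma (k + (α + 2 * i) + 1))) := by
  have hpos : 0 < α + (k + i : ℕ) + 1 := by linarith [(k + i).cast_nonneg (α := ℝ)]
  have hΓ := Gamma_add_natCast hpos i
  have hfactorial : (k.factorial : ℝ) * (k + i).descFactorial i = (k + i).factorial := by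
    exact_mod_cast Nat.add_sub_cancel k i ▸ Nat.factorial_mul_descFactorial (Nat.le_add_left i k)
  have := Real.Gamma_pos_of_pos hpos
  have := ascPochhammer_pos i _ hpos
  have : ((k + i).descFactorial i : ℝ) ≠ 0 :=
    right_ne_zero_of_mul (hfactorial.trans_ne (by positivity))
  rw [show (k : ℝ) + (α + 2 * i) + 1 = α + (k + i : ℕ) + 1 + i by push_cast; ring, hΓ,
    besselMultiplier, taylorLimit, ← hfactorial]
  field_simp

theorem hasSum_scaledBessel (hα : -1 < α) (i : ℕ) (z : ℂ) :
    HasSum (fun s => ((besselMultiplier α i s * taylorLimit α s : ℝ) : ℂ) * (-z ^ 2 / 2) ^ s)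
      (2 ^ i * scaledBessel α i z) := by
  have hsum : Summable fun s =>
      ((besselMultiplier α i s * taylorLimit α s : ℝ) : ℂ) * (-z ^ 2 / 2) ^ s := by
    refine .of_norm_bounded ((summable_taylorLimit_mul_pow hα ‖-z ^ 2 / 2‖).mul_left (2 ^ i))
      fun s => ?_
    rw [norm_mul, norm_pow, Complex.norm_real, norm_mul, Real.norm_eq_abs, Real.norm_eq_abs,
      abs_of_pos (taylorLimit_pos hα s), mul_assoc]
    have := (taylorLimit_pos hα s).le
    gcongr
    exact abs_besselMultiplier_le hα i s
  convert hsum.hasSum using 1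
  rw [← hsum.sum_add_tsum_nat_add i, Finset.sum_eq_zero fun s hs => ?_, zero_add,
    scaledBessel_eq_tsum, ← tsum_mul_left]
  · refine tsum_congr fun k => ?_
    have hsign : (-2 : ℂ) ^ i * (-1) ^ i = 2 ^ i := by norm_num [← mul_pow]
    have hpow : (-z ^ 2 / 2) ^ (k + i) =
        (-1) ^ k * (-1) ^ i * 2 ^ (k + i) * (z / 2) ^ (2 * (k + i)) := by
      rw [← pow_add, pow_mul, ← mul_pow, ← mul_pow]
      ring
    rw [besselMultiplier_mul_taylorLimit_add hα, hpow, ← hsign]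
    push_cast
    field_simp
  · simp [besselMultiplier, Nat.descFactorial_of_lt (Finset.mem_range.mp hs)]

theorem hasSum_phiLimit (hα : -1 < α) (z : ℂ) :
    HasSum (fun s => (taylorLimit α s : ℂ) * (-z ^ 2 / 2) ^ s) (phiLimit α z) := by
  simpa [besselMultiplier, phiLimit] using hasSum_scaledBessel hα 0 z

/-- The data of the recursion when the effective mass is asymptotically `ρ` times the critical mass
divided by `n ^ (2 * (α + 2 * j + 1))`. -/
noncomputable def massData (α : ℝ) (j : ℕ) (ρ : ℝ) (i : ℕ) : ℝ :=
  1 - ρ * ((α + 2 * j + 1) / (α + j + i + 1))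

theorem sum_besselCoeff_massData_mul_besselMultiplier (hα : -1 < α) (j : ℕ) (ρ : ℝ) (s : ℕ) :
    ∑ i ∈ Finset.range (j + 2), besselCoeff α (massData α j ρ) i * besselMultiplier α i s =
      massData α j ρ s := by
  refine sum_besselCoeff_mul_besselMultiplier_of_natDegree_le hα (N := j + 1)
    (q := (X + C (α + j + 1 - ρ * (α + 2 * j + 1))) * (ascPochhammer ℝ j).comp (X + C (α + 1)))
    ?_ (fun s => ?_) s
  · refine natDegree_mul_le.trans ?_
    rw [natDegree_comp, natDegree_X_add_C, natDegree_X_add_C, ascPochhammer_natDegree]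
    omega
  · have : 0 < α + j + s + 1 := by linarith [j.cast_nonneg (α := ℝ), s.cast_nonneg (α := ℝ)]
    simp only [eval_mul, eval_comp, eval_add, eval_X, eval_C]
    rw [ascPochhammer_succ_eval, massData, show (s : ℝ) + (α + 1) = α + s + 1 by ring]
    field_simp
    ring

theorem hasSum_besselCombination (hα : -1 < α) (j : ℕ) (ρ : ℝ) (z : ℂ) :
    HasSum (fun s => ((massData α j ρ s * taylorLimit α s : ℝ) : ℂ) * (-z ^ 2 / 2) ^ s)
      (besselCombination α j (besselCoeff α (massData α j ρ)) z) := by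
  have hsum := hasSum_sum fun i (_ : i ∈ Finset.range (j + 2)) =>
    (hasSum_scaledBessel hα i z).mul_left (besselCoeff α (massData α j ρ) i : ℂ)
  simp only [← mul_assoc] at hsum
  refine hsum.congr_fun fun s => ?_
  rw [← sum_besselCoeff_massData_mul_besselMultiplier hα, ← Finset.sum_mul]
  push_cast [Finset.sum_mul]
  simp only [mul_assoc]

theorem psiData_eq_massData (hα : -1 < α) {β M : ℝ} {j : ℕ} (hM : M + criticalMass α β j ≠ 0) :
    psiData α β j M = massData α j (M / (M + criticalMass α β j)) := by
  funext i
  have : 0 < α + j + i + 1 := by linarith [j.cast_nonneg (α := ℝ), i.cast_nonneg (α := ℝ)]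
  rw [psiData, massData]
  field_simp
  ring

theorem varphiData_eq_massData (hα : -1 < α) (j : ℕ) : varphiData α j = massData α j 1 := by
  funext i
  have : 0 < α + j + i + 1 := by linarith [j.cast_nonneg (α := ℝ), i.cast_nonneg (α := ℝ)]
  rw [varphiData, massData]
  field_simp
  ring

/-! ### From Taylor coefficients to uniform convergence -/

theorem tendstoUniformlyOn_of_tendsto_prod_nhds {ι X Y : Type*} [TopologicalSpace X]
    [UniformSpace Y] {F : ι → X → Y} {f : X → Y} {p : Filter ι} {K : Set X} (hK : IsCompact K)
    (hf : ∀ x ∈ K, ContinuousAt f x)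
    (hF : ∀ x ∈ K, Tendsto (fun q : ι × X => F q.1 q.2) (p ×ˢ 𝓝 x) (𝓝 (f x))) :
    TendstoUniformlyOn F f p K := by
  rw [← tendstoLocallyUniformlyOn_iff_tendstoUniformlyOn_of_compact hK,
    tendstoLocallyUniformlyOn_iff_forall_tendsto]
  intro x hx
  have hpair := ((hf x hx).tendsto.comp tendsto_snd).prodMk_nhds (hF x hx)
  exact (hpair.mono_right (nhds_le_uniformity _)).mono_left
    (prod_mono_right _ nhdsWithin_le_nhds)

theorem tendsto_tsum_mul_pow {ι 𝕜 : Type*} [NormedField 𝕜] [CompleteSpace 𝕜] {p : Filter ι}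
    {c : ι → ℕ → 𝕜} {l : ℕ → 𝕜} {E : ℕ → ℝ} (hE : ∀ x : ℝ, Summable fun i => E i * x ^ i)
    (hc : ∀ i, Tendsto (fun q => c q i) p (𝓝 (l i))) (hcE : ∀ᶠ q in p, ∀ i, ‖c q i‖ ≤ E i)
    {w : ι → 𝕜} {w₀ : 𝕜} (hw : Tendsto w p (𝓝 w₀)) :
    Tendsto (fun q => ∑' i, c q i * w q ^ i) p (𝓝 (∑' i, l i * w₀ ^ i)) := by
  refine tendsto_tsum_of_dominated_convergence (hE (‖w₀‖ + 1))
    (fun i => (hc i).mul (hw.pow i)) ?_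
  filter_upwards [hcE, hw.norm.eventually_le_const (lt_add_one _)] with q hq hwq i
  rw [norm_mul, norm_pow]
  exact mul_le_mul (hq i) (by gcongr) (by positivity) ((norm_nonneg _).trans (hq i))

theorem aeval_one_add_div_rpow (Q : ℝ[X]) (α : ℝ) {n : ℕ} (hn : 0 < n) (w : ℂ) :
    aeval (1 + w / (n : ℂ) ^ 2) Q / (((n : ℝ) ^ α : ℝ) : ℂ) =
      ∑' i, (((taylor 1 Q).coeff i / (n : ℝ) ^ (α + 2 * i) : ℝ) : ℂ) * w ^ i := by
  have hn' : (0 : ℝ) < n := by exact_mod_cast hn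
  have hQ : aeval (1 + w / (n : ℂ) ^ 2) Q = aeval (w / (n : ℂ) ^ 2) (taylor 1 Q) := by
    rw [taylor_apply, aeval_comp]
    simp [add_comm]
  rw [hQ, aeval_eq_sum_range, Finset.sum_div,
    tsum_eq_sum (s := Finset.range ((taylor 1 Q).natDegree + 1)) fun i hi => ?_]
  · refine Finset.sum_congr rfl fun i _ => ?_
    have hpow : (n : ℝ) ^ (α + 2 * i) = n ^ α * (n ^ 2) ^ i := by
      rw [Real.rpow_add hn', ← pow_mul]
      exact_mod_cast rfl
    rw [Complex.real_smul, hpow, div_pow]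
    push_cast
    field_simp
  · rw [coeff_eq_zero_of_natDegree_lt (by simpa using hi)]
    simp

theorem tendstoUniformlyOn_aeval_one_add_div {X : Type*} [TopologicalSpace X] {Q : ℕ → ℝ[X]}
    {l E : ℕ → ℝ} (hE : ∀ x : ℝ, Summable fun i => E i * x ^ i)
    (hlim : ∀ i : ℕ, Tendsto (fun n : ℕ => (taylor 1 (Q n)).coeff i / (n : ℝ) ^ (α + 2 * i)) atTop
      (𝓝 (l i)))
    (hdom : ∀ᶠ n : ℕ in atTop, ∀ i : ℕ,
      |(taylor 1 (Q n)).coeff i / (n : ℝ) ^ (α + 2 * i)| ≤ E i)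
    {v : X → ℂ} (hv : Continuous v) {F : X → ℂ}
    (hF : ∀ x, HasSum (fun i => (l i : ℂ) * v x ^ i) (F x)) {w : ℕ → X → ℂ}
    (hw : ∀ x, Tendsto (fun q : ℕ × X => w q.1 q.2) (atTop ×ˢ 𝓝 x) (𝓝 (v x)))
    {K : Set X} (hK : IsCompact K) :
    TendstoUniformlyOn
      (fun n x => aeval (1 + w n x / (n : ℂ) ^ 2) (Q n) / (((n : ℝ) ^ α : ℝ) : ℂ)) F atTop K := by
  have hl : ∀ i, ‖(l i : ℂ)‖ ≤ E i := fun i => by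
    rw [Complex.norm_real]
    exact le_of_tendsto (hlim i).abs (hdom.mono fun n h => h i)
  have htsum : F = fun x => ∑' i, (l i : ℂ) * v x ^ i := funext fun x => (hF x).tsum_eq.symm
  refine tendstoUniformlyOn_of_tendsto_prod_nhds hK (fun x _ => ?_) fun x _ => ?_
  · rw [htsum]
    exact tendsto_tsum_mul_pow (c := fun _ i => (l i : ℂ)) hE (fun _ => tendsto_const_nhds)
      (.of_forall fun _ => hl) hv.continuousAt
  · rw [htsum]
    refine (tendsto_tsum_mul_pow hE (fun i => ((Complex.continuous_ofReal.tendsto _).comp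
      (hlim i)).comp tendsto_fst) ?_ (hw x)).congr' ?_
    · filter_upwards [hdom.prod_inl (𝓝 x)] with q hq i
      simpa only [Function.comp_apply, Complex.norm_real, Real.norm_eq_abs] using hq i
    · filter_upwards [(eventually_gt_atTop 0).prod_inl (𝓝 x)] with q hq
      exact (aeval_one_add_div_rpow (Q q.1) α hq (w q.1 q.2)).symm

theorem tendsto_sq_mul_cos_div_sub_one (z : ℂ) :
    Tendsto (fun q : ℕ × ℂ => (q.1 : ℂ) ^ 2 * (Complex.cos (q.2 / q.1) - 1)) (atTop ×ˢ 𝓝 z)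
      (𝓝 (-z ^ 2 / 2)) := by
  have hhalf : Tendsto (fun q : ℕ × ℂ => q.2 / 2 * (q.1 : ℂ)⁻¹) (atTop ×ˢ 𝓝 z) (𝓝 0) := by
    simpa using ((tendsto_snd (f := (atTop : Filter ℕ))).div_const 2).mul
      ((tendsto_inv_atTop_nhds_zero_nat (𝕜 := ℂ)).comp tendsto_fst)
  have hsinc : Tendsto (dslope Complex.sin 0) (𝓝 0) (𝓝 1) := by
    simpa [ContinuousAt] using
      continuousAt_dslope_same.mpr (Complex.differentiable_sin.differentiableAt (x := 0))
  have hlim := (((tendsto_snd.div_const 2).mul (hsinc.comp hhalf)).pow 2).const_mul (-2)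
  rw [show -2 * (z / 2 * 1) ^ 2 = -z ^ 2 / 2 by ring] at hlim
  refine hlim.congr' ?_
  filter_upwards [(eventually_gt_atTop 0).prod_inl (𝓝 z)] with q hq
  have hq' : (q.1 : ℂ) ≠ 0 := by exact_mod_cast hq.ne'
  have hsin := sub_smul_dslope Complex.sin 0 (q.2 / 2 * (q.1 : ℂ)⁻¹)
  rw [Complex.sin_zero, sub_zero, sub_zero, smul_eq_mul] at hsin
  rw [show q.2 / q.1 = 2 * (q.2 / 2 * (q.1 : ℂ)⁻¹) by ring, Complex.cos_two_mul_eq_one_sub, ← hsin]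
  simp only [Function.comp_apply]
  field_simp
  ring

theorem mehlerHeine_of_tendsto_taylor_coeff {Q : ℕ → ℝ[X]} {l E : ℕ → ℝ}
    (hE : ∀ x : ℝ, Summable fun i => E i * x ^ i)
    (hlim : ∀ i : ℕ, Tendsto (fun n : ℕ => (taylor 1 (Q n)).coeff i / (n : ℝ) ^ (α + 2 * i)) atTop
      (𝓝 (l i)))
    (hdom : ∀ᶠ n : ℕ in atTop, ∀ i : ℕ,
      |(taylor 1 (Q n)).coeff i / (n : ℝ) ^ (α + 2 * i)| ≤ E i)
    {F : ℂ → ℂ} (hF : ∀ z, HasSum (fun i => (l i : ℂ) * (-z ^ 2 / 2) ^ i) (F z)) :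
    MehlerHeine α Q F := by
  intro K hK
  have hcos (n : ℕ) (z : ℂ) :
      Complex.cos (z / n) = 1 + (n : ℂ) ^ 2 * (Complex.cos (z / n) - 1) / (n : ℂ) ^ 2 := by
    rcases eq_or_ne (n : ℂ) 0 with hn | hn
    · simp [hn]
    · rw [mul_div_cancel_left₀ _ (pow_ne_zero 2 hn), add_sub_cancel]
  have hquad (n : ℕ) (z : ℂ) :
      1 - z ^ 2 / (2 * (n : ℂ) ^ 2) = 1 + -z ^ 2 / 2 / (n : ℂ) ^ 2 := by ring
  have hv : Continuous fun z : ℂ => -z ^ 2 / 2 := by fun_prop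
  constructor
  · simp_rw +singlePass [hcos]
    exact tendstoUniformlyOn_aeval_one_add_div hE hlim hdom hv hF
      tendsto_sq_mul_cos_div_sub_one hK
  · simp_rw [hquad]
    exact tendstoUniformlyOn_aeval_one_add_div hE hlim hdom hv hF
      (fun z => (hv.tendsto z).comp tendsto_snd) hK

/-! ### The three mass regimes -/

theorem tendsto_jacobiTaylor_div (hα : -1 < α) (β : ℝ) (i : ℕ) :
    Tendsto (fun n : ℕ => jacobiTaylor α β n i / (n : ℝ) ^ (α + 2 * i)) atTop
      (𝓝 (taylorLimit α i)) := by
  refine tendsto_div_of_isEquivalent_const_mul (isEquivalent_jacobiTaylor hα β i) ?_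
  filter_upwards [eventually_gt_atTop 0] with n hn
  positivity

theorem tendsto_kernelTaylor_div (hα : -1 < α) (hβ : -1 < β) (j i : ℕ) :
    Tendsto (fun n : ℕ => kernelTaylor α β j n i / (n : ℝ) ^ (2 * (α + i + j + 1))) atTop
      (𝓝 (kernelLimit α β j i)) := by
  refine tendsto_div_of_isEquivalent_const_mul (isEquivalent_kernelTaylor hα hβ j i) ?_
  filter_upwards [eventually_gt_atTop 0] with n hn
  positivity

section EffectiveMass

variable {j : ℕ} {e : ℕ → ℝ} {ρ : ℝ}

theorem tendsto_mul_jacobiTaylor_mul_kernelTaylor_div (hα : -1 < α) (hβ : -1 < β)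
    (he : Tendsto (fun n => e n * (n : ℝ) ^ (2 * (α + 2 * j + 1))) atTop
      (𝓝 (ρ * criticalMass α β j))) (i : ℕ) :
    Tendsto (fun n => e n * jacobiTaylor α β n j * kernelTaylor α β j n i / (n : ℝ) ^ (α + 2 * i))
      atTop (𝓝 (ρ * ((α + 2 * j + 1) / (α + j + i + 1)) * taylorLimit α i)) := by
  have hlim := (he.mul (tendsto_jacobiTaylor_div hα β j)).mul (tendsto_kernelTaylor_div hα hβ j i)
  have hc := (criticalMass_pos hα β j).ne'
  have hvalue : ρ * criticalMass α β j * taylorLimit α j * kernelLimit α β j i =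
      ρ * ((α + 2 * j + 1) / (α + j + i + 1)) * taylorLimit α i := by
    rw [mul_assoc, taylorLimit_mul_kernelLimit hα]
    field_simp
  rw [hvalue] at hlim
  refine hlim.congr' ?_
  filter_upwards [eventually_gt_atTop 0] with n hn
  have hn' : (0 : ℝ) < n := by exact_mod_cast hn
  have hpow : (n : ℝ) ^ (α + 2 * j) * (n : ℝ) ^ (2 * (α + i + j + 1)) =
      (n : ℝ) ^ (2 * (α + 2 * j + 1)) * (n : ℝ) ^ (α + 2 * i) := by
    rw [← Real.rpow_add hn', ← Real.rpow_add hn']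
    ring_nf
  rw [mul_div_assoc', mul_div_assoc', div_mul_eq_mul_div, div_div, hpow]
  field_simp

theorem tendsto_sobolevTaylor_div (hα : -1 < α) (hβ : -1 < β)
    (he : Tendsto (fun n => e n * (n : ℝ) ^ (2 * (α + 2 * j + 1))) atTop
      (𝓝 (ρ * criticalMass α β j))) (i : ℕ) :
    Tendsto (fun n => sobolevTaylor α β j (e n) n i / (n : ℝ) ^ (α + 2 * i)) atTop
      (𝓝 (massData α j ρ i * taylorLimit α i)) := by
  rw [massData, sub_mul, one_mul]
  simp_rw [sobolevTaylor, sub_div]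
  exact (tendsto_jacobiTaylor_div hα β i).sub
    (tendsto_mul_jacobiTaylor_mul_kernelTaylor_div hα hβ he i)

theorem exists_eventually_abs_sobolevTaylor_div_le (hα : -1 < α) (hβ : -1 < β)
    (he : Tendsto (fun n => e n * (n : ℝ) ^ (2 * (α + 2 * j + 1))) atTop
      (𝓝 (ρ * criticalMass α β j))) :
    ∃ B, ∀ᶠ n : ℕ in atTop, ∀ i : ℕ,
      |sobolevTaylor α β j (e n) n i / (n : ℝ) ^ (α + 2 * i)| ≤ B * taylorMajorant α β i := by
  have hbound := (tendsto_jacobiTaylor_div hα β 0).add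
    (tendsto_mul_jacobiTaylor_mul_kernelTaylor_div hα hβ he 0).abs
  obtain ⟨B, hB⟩ := hbound.isBoundedUnder_le
  refine ⟨B, ?_⟩
  filter_upwards [eventually_map.mp hB, eventually_gt_atTop 0] with n hB hn i
  have hn' : (0 : ℝ) < n := by exact_mod_cast hn
  have hKi := kernelTaylor_nonneg hα hβ j n i
  have hK₀ := kernelTaylor_nonneg hα hβ j n 0
  have hpow : (n : ℝ) ^ (α + 2 * i) = n ^ (α + 2 * (0 : ℕ)) * n ^ (2 * i) := by
    rw [Nat.cast_zero, mul_zero, add_zero, Real.rpow_add hn']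
    exact_mod_cast rfl
  rw [abs_div, abs_of_pos (by positivity : 0 < (n : ℝ) ^ (α + 2 * i)), div_le_iff₀ (by positivity)]
  calc |sobolevTaylor α β j (e n) n i|
    _ ≤ jacobiTaylor α β n i + |e n * jacobiTaylor α β n j| * kernelTaylor α β j n i := by
      refine (abs_sub (jacobiTaylor α β n i) _).trans_eq ?_
      rw [abs_of_nonneg (jacobiTaylor_nonneg hα hβ n i), abs_mul _ (kernelTaylor α β j n i),
        abs_of_nonneg hKi]
    _ ≤ jacobiTaylor α β n 0 * (taylorMajorant α β i * n ^ (2 * i)) +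
          |e n * jacobiTaylor α β n j| *
            (kernelTaylor α β j n 0 * (taylorMajorant α β i * n ^ (2 * i))) := by
      gcongr
      · exact jacobiTaylor_le hα hβ n i
      · exact kernelTaylor_le hα hβ j n i
    _ = (jacobiTaylor α β n 0 / n ^ (α + 2 * (0 : ℕ)) +
          |e n * jacobiTaylor α β n j * kernelTaylor α β j n 0 / n ^ (α + 2 * (0 : ℕ))|) *
            taylorMajorant α β i * n ^ (α + 2 * i) := by
      have : 0 < (n : ℝ) ^ (α + 2 * (0 : ℕ)) := by positivity
      rw [hpow, abs_div, abs_of_pos this, abs_mul _ (kernelTaylor α β j n 0), abs_of_nonneg hK₀]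
      field_simp
    _ ≤ B * taylorMajorant α β i * n ^ (α + 2 * i) := by
      have := taylorMajorant_nonneg hα β i
      gcongr

theorem mehlerHeine_of_tendsto_effectiveMass (hα : -1 < α) (hβ : -1 < β) {m : ℕ → ℝ}
    {Q : ℕ → ℝ[X]} (hQ : ∀ n, IsJacobiSobolev α β j (m n) n (Q n))
    (he : Tendsto (fun n => effectiveMass α β j (m n) n * (n : ℝ) ^ (2 * (α + 2 * j + 1))) atTop
      (𝓝 (ρ * criticalMass α β j))) {F : ℂ → ℂ}
    (hF : ∀ z, HasSum (fun i => ((massData α j ρ i * taylorLimit α i : ℝ) : ℂ) *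
      (-z ^ 2 / 2) ^ i) (F z)) :
    MehlerHeine α Q F := by
  have hcoeff : ∀ᶠ n : ℕ in atTop, ∀ i, (taylor 1 (Q n)).coeff i =
      sobolevTaylor α β j (effectiveMass α β j (m n) n) n i :=
    (eventually_ge_atTop j).mono fun n hn => taylor_coeff_eq_sobolevTaylor hα hβ (hQ n) hn
  obtain ⟨B, hB⟩ := exists_eventually_abs_sobolevTaylor_div_le hα hβ he
  refine mehlerHeine_of_tendsto_taylor_coeff (E := fun i => B * taylorMajorant α β i)
    (fun x => ?_) (fun i => ?_) ?_ hF
  · simpa only [mul_assoc] using (summable_taylorMajorant_mul_pow α β x).mul_left B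
  · refine (tendsto_sobolevTaylor_div hα hβ he i).congr' ?_
    filter_upwards [hcoeff] with n hn
    rw [hn]
  · filter_upwards [hcoeff, hB] with n hn hB i
    rw [hn]
    exact hB i

end EffectiveMass

theorem rpow_mul_rpow_sub_eventuallyEq (m : ℕ → ℝ) (γ δ : ℝ) :
    (fun n : ℕ => m n * (n : ℝ) ^ γ * (n : ℝ) ^ (δ - γ)) =ᶠ[atTop]
      fun n : ℕ => m n * (n : ℝ) ^ δ := by
  filter_upwards [eventually_gt_atTop 0] with n hn
  rw [mul_assoc, ← Real.rpow_add (by exact_mod_cast hn), add_sub_cancel]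

theorem tendsto_mul_rpow_zero_of_lt {m : ℕ → ℝ} {γ δ M : ℝ} (hδ : δ < γ)
    (hm : Tendsto (fun n : ℕ => m n * (n : ℝ) ^ γ) atTop (𝓝 M)) :
    Tendsto (fun n : ℕ => m n * (n : ℝ) ^ δ) atTop (𝓝 0) := by
  have hzero := (tendsto_rpow_neg_atTop (sub_pos.mpr hδ)).comp tendsto_natCast_atTop_atTop
  rw [neg_sub] at hzero
  have hprod := hm.mul hzero
  rw [mul_zero] at hprod
  exact hprod.congr' (rpow_mul_rpow_sub_eventuallyEq m γ δ)

theorem tendsto_abs_mul_rpow_atTop_of_lt {m : ℕ → ℝ} {γ δ M : ℝ} (hδ : γ < δ) (hM : M ≠ 0)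
    (hm : Tendsto (fun n : ℕ => m n * (n : ℝ) ^ γ) atTop (𝓝 M)) :
    Tendsto (fun n : ℕ => |m n * (n : ℝ) ^ δ|) atTop atTop := by
  have htop := (tendsto_rpow_atTop (sub_pos.mpr hδ)).comp
    (tendsto_natCast_atTop_atTop (R := ℝ))
  refine (hm.abs.pos_mul_atTop (abs_pos.mpr hM) htop).congr' ?_
  filter_upwards [rpow_mul_rpow_sub_eventuallyEq m γ δ] with n hn
  rw [← hn, abs_mul _ ((n : ℝ) ^ (δ - γ)), abs_of_nonneg (by positivity : 0 ≤ (n : ℝ) ^ (δ - γ)),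
    Function.comp_apply]

end JacobiSobolev

open JacobiSobolev

theorem theorem2_general (α β : ℝ) (hα : -1 < α) (hβ : -1 < β) (j : ℕ) (γ M : ℝ) (m : ℕ → ℝ)
    (hm_lim : Tendsto (fun n : ℕ => m n * (n : ℝ) ^ γ) atTop (𝓝 M))
    (Q : ℕ → ℝ[X]) (hQ : ∀ n, IsJacobiSobolev α β j (m n) n (Q n)) :
    (2 * (α + 2 * j + 1) < γ → MehlerHeine α Q (phiLimit α)) ∧
    (γ = 2 * (α + 2 * j + 1) → M + criticalMass α β j ≠ 0 →
      MehlerHeine α Q (psiLimit α β j M)) ∧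
    (γ < 2 * (α + 2 * j + 1) → M ≠ 0 → MehlerHeine α Q (varphiLimit α j)) := by
  refine ⟨fun hγ => ?_, fun hγ hMc => ?_, fun hγ hM => ?_⟩
  · have he := tendsto_effectiveMass_mul_rpow hα hβ (tendsto_mul_rpow_zero_of_lt hγ hm_lim)
      (by simpa only [zero_add] using (criticalMass_pos hα β j).ne')
    rw [zero_div] at he
    refine mehlerHeine_of_tendsto_effectiveMass hα hβ hQ he fun z => ?_
    simpa only [massData, zero_mul, sub_zero, one_mul] using hasSum_phiLimit hα z
  · subst hγ
    refine mehlerHeine_of_tendsto_effectiveMass hα hβ hQ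
      (tendsto_effectiveMass_mul_rpow hα hβ hm_lim hMc) fun z => ?_
    rw [psiLimit, psiData_eq_massData hα hMc]
    exact hasSum_besselCombination hα j _ z
  · have he := tendsto_effectiveMass_mul_rpow_of_abs_atTop hα hβ
      (tendsto_abs_mul_rpow_atTop_of_lt hγ hM hm_lim)
    rw [← one_mul (criticalMass α β j)] at he
    refine mehlerHeine_of_tendsto_effectiveMass hα hβ hQ he fun z => ?_
    rw [varphiLimit, varphiData_eq_massData hα]
    exact hasSum_besselCombination hα j 1 z

theorem theorem2 (α β : ℝ) (hα : -1 < α) (hβ : -1 < β) (j : ℕ) (γ M : ℝ) (hM : 0 < M)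
    (m : ℕ → ℝ) (hm_nonneg : ∀ n, 0 ≤ m n)
    (hm_lim : Tendsto (fun n : ℕ => m n * (n : ℝ) ^ γ) atTop (𝓝 M))
    (Q : ℕ → ℝ[X]) (hQ : ∀ n, IsJacobiSobolev α β j (m n) n (Q n)) :
    (2 * (α + 2 * j + 1) < γ → MehlerHeine α Q (phiLimit α)) ∧
    (γ = 2 * (α + 2 * j + 1) → MehlerHeine α Q (psiLimit α β j M)) ∧
    (γ < 2 * (α + 2 * j + 1) → MehlerHeine α Q (varphiLimit α j)) := by
  obtain ⟨hphi, hpsi, hvarphi⟩ := theorem2_general α β hα hβ j γ M m hm_lim Q hQ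
  exact ⟨hphi, (hpsi · (add_pos hM (criticalMass_pos hα β j)).ne'), (hvarphi · hM.ne')⟩
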